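/- Let $(M,\mathcal T)$ be a triangulated connected closed surface with vertex set $V=\{1,\dots,N\}$, edge set $E$ and face set $F$, let $\Phi:E\to[0,\pi/2]$ be a weight, and let $\alpha\in\mathbb R$. A circle packing metric is a vector $r\in\mathbb R_{>0}^V$. It makes each edge $\{i,j\}$ a segment of length $l_{ij}=\sqrt{r_i^2+r_j^2+2r_ir_j\cos\Phi_{ij}}$ and each face a Euclidean triangle; let $K_i=2\pi-\sum_{\{i,j,k\}\in F}\theta_i^{jk}$, where $\theta_i^{jk}$ is the inner angle at $i$ of the face $\{i,j,k\}$. The $\alpha$-curvature at $i$ is $R_{\alpha,i}=K_i/r_i^\alpha$, and $r$ is a constant $\alpha$-curvature metric if $R_{\alpha,i}$ does not depend on $i$. Put $u_i=\ln r_i$, $\|r\|_\alpha^\alpha=\sum_i r_i^\alpha$ and $s_\alpha=2\pi\chi(M)/\|r\|_\alpha^\alpha$. The $\alpha$-Laplacian at $r$ is $(\Delta_\alpha f)_i=-r_i^{-\alpha}\sum_j\frac{\partial K_i}{\partial u_j}f_j$ for $f\in\mathbb R^V$, and $\lambda_1(-\Delta_\alpha)$ denotes the smallest positive eigenvalue of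 $-\Delta_\alpha$. The $\alpha$-flow is $$\frac{du_i}{dt}=s_\alpha r_i^\alpha-K_i .$$ Theorem. Suppose that $\lambda_1(-\Delta_\alpha)>\alpha s_\alpha=\alpha\,\frac{2\pi\chi(M)}{\|r\|_\alpha^\alpha}$ at every circle packing metric $r\in\mathbb R_{>0}^V$. Then: 1. For every initial value $u_0\in\mathbb R^V$ the $\alpha$-flow has exactly one solution $u(t)$, $t\in\mathbb R$, with $u(0)=u_0$. 2. For every solution $u(t)$ of the $\alpha$-flow, $u(t)$ converges in $\mathbb R^V$ as $t\to+\infty$ (that is, the metric $r(t)$ converges to a circle packing metric) if and only if there exists a constant $\alpha$-curvature metric. 3. If there exists a constant $\alpha$-curvature metric, then every solution $u(t)$ converges exponentially fast to the logarithmic coordinates $u'$ of such a metric: there are $C\in\mathbb R$ and $\delta>0$ with $\|u(t)-u'\|\le Ce^{-\delta t}$ for all $t\ge 0$. 4. For each $u_0\in\mathbb R^V$ the $\alpha$-potential $F(u)=\int_{u_0}^u\sum_i(K_i-s_\alpha r_i^\alpha)\,du_i$, the integral being taken along the straight segment, satisfies $dF=\sum_i(K_i-s_\alpha r_i^\alpha)\,du_i$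 on $\mathbb R^V$ and is strictly convex on the hyperplane $\mathscr U=\{u\in\mathbb R^V:\sum_iu_i=0\}$. If there exists a constant $\alpha$-curvature metric, then the restriction $F|_{\mathscr U}$ is a proper map to $\mathbb R$ and $F(u)\to+\infty$ as $u\to\infty$ in $\mathscr U$. -/

import Mathlib

open Filter Topology

noncomputable section

namespace AlphaFlow

variable {V : Type*} [Fintype V] [DecidableEq V]

/-! ### Triangulated closed surfaces -/

open Classical in
/-- The finite set of `n`-dimensional simplices of `T` (sets of `n + 1` vertices). -/
def simplices (T : AbstractSimplicialComplex V) (n : ℕ) : Finset (Finset V) :=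
  Finset.univ.filter fun s => s ∈ T ∧ s.card = n + 1

/-- The edges of `T`. -/
abbrev edges (T : AbstractSimplicialComplex V) : Finset (Finset V) := simplices T 1

/-- The faces (triangles) of `T`. -/
abbrev triangles (T : AbstractSimplicialComplex V) : Finset (Finset V) := simplices T 2

/-- The Euler characteristic `|V| - |E| + |F|`. -/
def eulerChar (T : AbstractSimplicialComplex V) : ℤ :=
  (Fintype.card V : ℤ) - (edges T).card + (triangles T).card

/-- The graph formed by the vertices and edges of `T`. -/
def oneSkeleton (T : AbstractSimplicialComplex V) : SimpleGraph V where
  Adj i j := i ≠ j ∧ ({i, j} : Finset V) ∈ edges T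
  symm := ⟨fun i j h => ⟨h.1.symm, by rw [Finset.pair_comm]; exact h.2⟩⟩
  loopless := ⟨fun _ h => h.1 rfl⟩

/-- The link of the vertex `i`: its vertices are the neighbours of `i`, and its edges are the edges
opposite to `i` in the triangles containing `i`. -/
def linkGraph (T : AbstractSimplicialComplex V) (i : V) :
    SimpleGraph {j : V // (oneSkeleton T).Adj i j} where
  Adj j k := j ≠ k ∧ ({i, j.1, k.1} : Finset V) ∈ triangles T
  symm := ⟨fun j k h => ⟨h.1.symm, by rw [Finset.pair_comm]; exact h.2⟩⟩
  loopless := ⟨fun _ h => h.1 rfl⟩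

/-- `T` is a triangulation of a (connected) closed surface: `T` is connected, every simplex lies in
a triangle, every edge lies in exactly two triangles, and the link of every vertex is connected.
By the edge condition each link is a finite 2-regular graph, so that it is a cycle. -/
structure IsClosedSurface (T : AbstractSimplicialComplex V) : Prop where
  connected : (oneSkeleton T).Connected
  exists_triangle : ∀ s ∈ T, ∃ f ∈ triangles T, s ⊆ f
  card_triangles : ∀ e ∈ edges T, ((triangles T).filter fun f => e ⊆ f).card = 2
  link_connected : ∀ i, (linkGraph T i).Connected

/-! ### Circle packing metrics and curvature -/

/-- The length `√(r_i² + r_j² + 2 r_i r_j cos Φ_ij)` of the edge `e = {i, j}`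
(see `edgeLength_pair`). -/
def edgeLength (Φ : Finset V → ℝ) (r : V → ℝ) (e : Finset V) : ℝ :=
  √(∑ i ∈ e, r i ^ 2 + 2 * (∏ i ∈ e, r i) * Real.cos (Φ e))

lemma edgeLength_pair {W : Type*} [DecidableEq W] (Φ : Finset W → ℝ) (r : W → ℝ)
    {i j : W} (h : i ≠ j) :
    edgeLength Φ r {i, j} = √(r i ^ 2 + r j ^ 2 + 2 * r i * r j * Real.cos (Φ {i, j})) := by
  rw [edgeLength, Finset.sum_pair h, Finset.prod_pair h, ← mul_assoc]

/-- The inner angle at `i` of the Euclidean triangle with vertices `f` and with the side lengths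
given by `edgeLength`, by the law of cosines. For `f = {i, j, k}` the set `f.erase i` is
`{j, k}`, so that the angle is `arccos ((l_ij² + l_ik² - l_jk²) / (2 l_ij l_ik))`
(see `innerAngle_triple`). -/
def innerAngle (Φ : Finset V → ℝ) (r : V → ℝ) (f : Finset V) (i : V) : ℝ :=
  Real.arccos
    ((∑ j ∈ f.erase i, edgeLength Φ r {i, j} ^ 2 - edgeLength Φ r (f.erase i) ^ 2) /
      (2 * ∏ j ∈ f.erase i, edgeLength Φ r {i, j}))

lemma innerAngle_triple {W : Type*} [DecidableEq W] (Φ : Finset W → ℝ) (r : W → ℝ)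
    {i j k : W} (hij : i ≠ j) (hik : i ≠ k)
    (hjk : j ≠ k) :
    innerAngle Φ r {i, j, k} i = Real.arccos
      ((edgeLength Φ r {i, j} ^ 2 + edgeLength Φ r {i, k} ^ 2 - edgeLength Φ r {j, k} ^ 2) /
        (2 * edgeLength Φ r {i, j} * edgeLength Φ r {i, k})) := by
  have h : ({i, j, k} : Finset W).erase i = {j, k} :=
    Finset.erase_insert (by simp [hij, hik])
  rw [innerAngle, h, Finset.sum_pair hjk, Finset.prod_pair hjk, ← mul_assoc]

/-- The classical discrete Gauss curvature `K_i = 2π - ∑ θ_i`, the sum being over the triangles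
that contain `i`. -/
def gaussCurv (T : AbstractSimplicialComplex V) (Φ : Finset V → ℝ) (r : V → ℝ) (i : V) : ℝ :=
  2 * Real.pi - ∑ f ∈ (triangles T).filter fun f => i ∈ f, innerAngle Φ r f i

/-- The discrete Gauss curvature of order `α`, `R_{α,i} = K_i / r_i ^ α`. -/
def alphaCurv (T : AbstractSimplicialComplex V) (Φ : Finset V → ℝ) (α : ℝ) (r : V → ℝ) (i : V) :
    ℝ :=
  gaussCurv T Φ r i / r i ^ α

/-- `r` is a circle packing metric whose `α`-curvature is constant. -/
def IsConstAlphaCurvMetric (T : AbstractSimplicialComplex V) (Φ : Finset V → ℝ) (α : ℝ)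
    (r : V → ℝ) : Prop :=
  (∀ i, 0 < r i) ∧ ∃ c : ℝ, ∀ i, alphaCurv T Φ α r i = c

/-- `s_α = 2π χ(M) / ∑ r_i ^ α`. -/
def sAlpha (T : AbstractSimplicialComplex V) (α : ℝ) (r : V → ℝ) : ℝ :=
  2 * Real.pi * (eulerChar T : ℝ) / ∑ i, r i ^ α

/-! ### The `α`-Laplacian -/

/-- The circle packing metric `r_i = exp u_i` with logarithmic coordinates `u`. -/
def metricOf (u : V → ℝ) : V → ℝ := fun i => Real.exp (u i)

/-- The Jacobian matrix `L = ∂(K_1, …, K_N) / ∂(u_1, …, u_N)` at the metric `r`,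
where `u_i = log r_i`. -/
def curvJacobian (T : AbstractSimplicialComplex V) (Φ : Finset V → ℝ) (r : V → ℝ) :
    Matrix V V ℝ :=
  Matrix.of fun i j =>
    fderiv ℝ (fun u : V → ℝ => gaussCurv T Φ (metricOf u) i) (fun k => Real.log (r k))
      (Pi.single j 1)

/-- The `α`-Laplacian `Δ_α f_i = -(1 / r_i ^ α) ∑ j, (∂K_i / ∂u_j) f_j`, as a matrix. -/
def alphaLaplacian (T : AbstractSimplicialComplex V) (Φ : Finset V → ℝ) (α : ℝ) (r : V → ℝ) :
    Matrix V V ℝ :=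
  Matrix.of fun i j => -(1 / r i ^ α) * curvJacobian T Φ r i j

/-- The first (smallest) positive eigenvalue of a square matrix. -/
def firstPosEigenvalue (A : Matrix V V ℝ) : ℝ :=
  sInf {l : ℝ | 0 < l ∧ Module.End.HasEigenvalue (Matrix.toLin' A) l}

/-! ### The `α`-flow and the `α`-potential -/

/-- `u`, defined for all times `t ∈ ℝ`, solves the `α`-flow `du_i/dt = s_α r_i ^ α - K_i`,
where `r_i = exp u_i`. -/
def IsAlphaFlow (T : AbstractSimplicialComplex V) (Φ : Finset V → ℝ) (α : ℝ)
    (u : ℝ → V → ℝ) : Prop :=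
  ∀ t i, HasDerivAt (fun τ => u τ i)
    (sAlpha T α (metricOf (u t)) * metricOf (u t) i ^ α - gaussCurv T Φ (metricOf (u t)) i) t

/-- The 1-form `∑ i, (K_i - s_α r_i ^ α) du_i` on `ℝ^V`. -/
def alphaForm (T : AbstractSimplicialComplex V) (Φ : Finset V → ℝ) (α : ℝ) (u : V → ℝ) :
    (V → ℝ) →L[ℝ] ℝ :=
  ∑ i, (gaussCurv T Φ (metricOf u) i - sAlpha T α (metricOf u) * metricOf u i ^ α) •
    ContinuousLinearMap.proj i

/-- The `α`-potential with base point `u₀`: the integral from `u₀` to `u` of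
`∑ i, (K_i - s_α r_i ^ α) du_i`, taken along the straight segment. -/
def alphaPotential (T : AbstractSimplicialComplex V) (Φ : Finset V → ℝ) (α : ℝ)
    (u₀ u : V → ℝ) : ℝ :=
  curveIntegral (alphaForm T Φ α) (Path.segment u₀ u)

variable (V) in
/-- The hyperplane `∑ u_i = 0`. -/
def sumZero : Set (V → ℝ) := {u | ∑ i, u i = 0}

end AlphaFlow

end

noncomputable section

namespace AlphaFlow

/-! ### Euclidean triangles spanned by three circles -/

/-! In logarithmic coordinates the flow is `u' = -G(u)` with `G = curvDefect`, `G_i = K_i - s_α r_i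
^ α`. Everything follows from `G` being the gradient of a function that is strictly convex modulo
constants. Its zeros are exactly the constant `α`-curvature metrics, because Gauss–Bonnet
(`sum_gaussCurv`) forces the constant to be `s_α`.

Inner angles are scale invariant, and for `i ≠ j` in a face `∂θ_i/∂u_j = ∂θ_j/∂u_i ≥ 0`, with the
explicit value `cornerWeight`. Hence the Jacobian of `K` is a weighted graph Laplacian: its
quadratic form `dirichletForm` is nonnegative and vanishes only on constants. Differentiating `s_α
r_i ^ α` subtracts `α s_α` times a variance with weights `r_i ^ α` (`sum_mul_fderiv_curvDefect`). By
the variational principle `mul_sum_lt_of_lt_firstPosEigenvalue`, the spectral hypothesis makes the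
difference positive on every nonconstant vector.

The rest needs only the properties collected in `IsMonotoneField`. The sum of the `u_i` is
conserved, and a zero of `G` can be moved along the constants into the hyperplane of the initial
value. Compactness bounds the Hessian from below on balls (`exists_pos_mul_norm_sq_le`); this gives
exponential decay of the distance to the zero, and linear growth of the potential. Global existence
uses that `G` is smooth and bounded. Conversely, the limit of a convergent trajectory is a zero of
`G`. -/

/-- The squared distance `p² + q² + 2 p q z` of the centres of two circles of radii `p` and `q`
whose intersection angle has cosine `z`. -/
def sqLen (p q z : ℝ) : ℝ := p ^ 2 + q ^ 2 + 2 * p * q * z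

/-- Four times the squared area of the triangle spanned by three circles of radii `p`, `q`, `s`. -/
def heron (p q s x y z : ℝ) : ℝ :=
  p ^ 2 * q ^ 2 * (1 - z ^ 2) + p ^ 2 * s ^ 2 * (1 - y ^ 2) + q ^ 2 * s ^ 2 * (1 - x ^ 2) +
    2 * p ^ 2 * q * s * (x + y * z) + 2 * q ^ 2 * p * s * (y + x * z) +
    2 * s ^ 2 * p * q * (z + x * y)

/-- The angle at the centre of the circle of radius `p` in the triangle spanned by three circles
of radii `p`, `q`, `s`. -/
def cornerAngle (p q s x y z : ℝ) : ℝ :=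
  Real.arccos ((sqLen p q z + sqLen p s y - sqLen q s x) /
    (2 * √(sqLen p q z) * √(sqLen p s y)))

/-- The derivative of the angle at the first vertex with respect to the logarithm of the radius of
the second circle. -/
def cornerWeight (p q s x y z : ℝ) : ℝ :=
  p * q / (√(heron p q s x y z) * sqLen p q z) *
    (p * q * (1 - z ^ 2) + s * (x * (p + q * z) + y * (q + p * z)))

lemma sqLen_comm (p q z : ℝ) : sqLen p q z = sqLen q p z := by
  unfold sqLen; ring

lemma sqLen_pos {p q z : ℝ} (hp : 0 < p) (hq : 0 < q) (hz : 0 ≤ z) : 0 < sqLen p q z := by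
  unfold sqLen; positivity

lemma heron_swap (p q s x y z : ℝ) : heron p q s x y z = heron q p s y x z := by
  unfold heron; ring

lemma heron_swap' (p q s x y z : ℝ) : heron p q s x y z = heron p s q x z y := by
  unfold heron; ring

/-- All six terms are nonnegative for cosines in `[0, 1]`. If `z = 0` the term `p² q²` survives;
otherwise `2 s² p q z` does. So the triangle of centres is never degenerate. -/
lemma heron_pos {p q s x y z : ℝ} (hp : 0 < p) (hq : 0 < q) (hs : 0 < s)
    (hx : x ∈ Set.Icc (0 : ℝ) 1) (hy : y ∈ Set.Icc (0 : ℝ) 1) (hz : z ∈ Set.Icc (0 : ℝ) 1) :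
    0 < heron p q s x y z := by
  obtain ⟨hx0, hx1⟩ := hx
  obtain ⟨hy0, hy1⟩ := hy
  obtain ⟨hz0, hz1⟩ := hz
  have h1 : 0 ≤ 1 - x ^ 2 := by nlinarith
  have h2 : 0 ≤ 1 - y ^ 2 := by nlinarith
  have h3 : 0 ≤ 1 - z ^ 2 := by nlinarith
  unfold heron
  rcases hz0.eq_or_lt with h | h
  · subst h
    norm_num
    positivity
  · positivity

/-- Heron's formula: both sides are sixteen times the squared area. -/
lemma four_mul_sqLen_mul_sqLen (p q s x y z : ℝ) :
    4 * sqLen p q z * sqLen p s y - (sqLen p q z + sqLen p s y - sqLen q s x) ^ 2 =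
      4 * heron p q s x y z := by
  unfold sqLen heron; ring

lemma cornerWeight_swap (p q s x y z : ℝ) :
    cornerWeight p q s x y z = cornerWeight q p s y x z := by
  unfold cornerWeight
  rw [heron_swap, sqLen_comm p q]
  ring

lemma cornerWeight_nonneg {p q s x y z : ℝ} (hp : 0 < p) (hq : 0 < q) (hs : 0 < s)
    (hx : 0 ≤ x) (hy : 0 ≤ y) (hz : z ∈ Set.Icc (0 : ℝ) 1) :
    0 ≤ cornerWeight p q s x y z := by
  obtain ⟨hz0, hz1⟩ := hz
  have h3 : 0 ≤ 1 - z ^ 2 := by nlinarith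
  have := sqLen_pos hp hq hz0
  unfold cornerWeight
  positivity

/-- The disjunction excludes the one case in which the weight vanishes: `z = 1` and `x = y = 0`, two
tangent circles both orthogonal to the third. -/
lemma cornerWeight_pos {p q s x y z : ℝ} (hp : 0 < p) (hq : 0 < q) (hs : 0 < s)
    (hx : x ∈ Set.Icc (0 : ℝ) 1) (hy : y ∈ Set.Icc (0 : ℝ) 1) (hz : z ∈ Set.Icc (0 : ℝ) 1)
    (h : z < 1 ∨ 0 < x ∨ 0 < y) : 0 < cornerWeight p q s x y z := by
  have hH := heron_pos hp hq hs hx hy hz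
  obtain ⟨hx0, hx1⟩ := hx
  obtain ⟨hy0, hy1⟩ := hy
  obtain ⟨hz0, hz1⟩ := hz
  have h3 : 0 ≤ 1 - z ^ 2 := by nlinarith
  have := sqLen_pos hp hq hz0
  unfold cornerWeight
  refine mul_pos (by positivity) ?_
  rcases h with h | h | h
  · have h3 : 0 < 1 - z ^ 2 := by nlinarith
    positivity
  · positivity
  · positivity

lemma cos_cornerAngle_arg_sq {p q s x y z : ℝ} (hc : 0 < sqLen p q z) (hb : 0 < sqLen p s y) :
    1 - ((sqLen p q z + sqLen p s y - sqLen q s x) /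
      (2 * √(sqLen p q z) * √(sqLen p s y))) ^ 2 =
      heron p q s x y z / (sqLen p q z * sqLen p s y) := by
  have h := four_mul_sqLen_mul_sqLen p q s x y z
  rw [div_pow, mul_pow, mul_pow, Real.sq_sqrt hc.le, Real.sq_sqrt hb.le]
  field_simp
  linarith

lemma cornerAngle_arg_mem {p q s x y z : ℝ} (hc : 0 < sqLen p q z) (hb : 0 < sqLen p s y)
    (hH : 0 < heron p q s x y z) :
    (sqLen p q z + sqLen p s y - sqLen q s x) / (2 * √(sqLen p q z) * √(sqLen p s y)) ∈
      Set.Ioo (-1 : ℝ) 1 := by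
  have h := cos_cornerAngle_arg_sq (x := x) hc hb
  have h' : 0 < heron p q s x y z / (sqLen p q z * sqLen p s y) := by positivity
  rw [← h] at h'
  constructor <;> nlinarith

lemma cos_cornerAngle {p q s x y z : ℝ} (hc : 0 < sqLen p q z) (hb : 0 < sqLen p s y)
    (hH : 0 < heron p q s x y z) :
    Real.cos (cornerAngle p q s x y z) =
      (sqLen p q z + sqLen p s y - sqLen q s x) / (2 * √(sqLen p q z) * √(sqLen p s y)) := by
  have h := cornerAngle_arg_mem hc hb hH
  exact Real.cos_arccos h.1.le h.2.le

lemma sin_cornerAngle {p q s x y z : ℝ} (hc : 0 < sqLen p q z) (hb : 0 < sqLen p s y) :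
    Real.sin (cornerAngle p q s x y z) =
      √(heron p q s x y z) / (√(sqLen p q z) * √(sqLen p s y)) := by
  rw [cornerAngle, Real.sin_arccos, cos_cornerAngle_arg_sq hc hb, Real.sqrt_div' _ (by positivity),
    Real.sqrt_mul hc.le]

/-- The addition formulas and Heron's identity give `cos (A + B) = cos (π - C)` and `sin (A + B) >
0`. The sign of the sine places `A + B` in `[0, π]`, where the cosine is injective. -/
lemma cornerAngle_add_add {p q s x y z : ℝ} (hp : 0 < p) (hq : 0 < q) (hs : 0 < s)
    (hx : x ∈ Set.Icc (0 : ℝ) 1) (hy : y ∈ Set.Icc (0 : ℝ) 1) (hz : z ∈ Set.Icc (0 : ℝ) 1) :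
    cornerAngle p q s x y z + cornerAngle q p s y x z + cornerAngle s p q z x y = Real.pi := by
  have hH := heron_pos hp hq hs hx hy hz
  have hH1 : heron q p s y x z = heron p q s x y z := heron_swap ..
  have hH2 : heron s p q z x y = heron p q s x y z := by unfold heron; ring
  have hc := sqLen_pos hp hq hz.1
  have hb := sqLen_pos hp hs hy.1
  have ha := sqLen_pos hq hs hx.1
  have hcA := cos_cornerAngle hc hb hH
  have hsA := sin_cornerAngle (x := x) hc hb
  have hcB := cos_cornerAngle (p := q) (q := p) (s := s) (x := y) (y := x) (z := z)
    (by rwa [sqLen_comm]) ha (by rwa [hH1])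
  have hsB := sin_cornerAngle (p := q) (q := p) (s := s) (x := y) (y := x) (z := z)
    (by rwa [sqLen_comm]) ha
  have hcC := cos_cornerAngle (p := s) (q := p) (s := q) (x := z) (y := x) (z := y)
    (by rwa [sqLen_comm]) (by rwa [sqLen_comm]) (by rwa [hH2])
  rw [sqLen_comm q p] at hcB hsB
  rw [sqLen_comm s p, sqLen_comm s q] at hcC
  rw [hH1] at hsB
  have h4 := four_mul_sqLen_mul_sqLen p q s x y z
  have hD := Real.sq_sqrt hH.le
  have hDpos := Real.sqrt_pos.2 hH
  set a := sqLen q s x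
  set b := sqLen p s y
  set c := sqLen p q z
  set D := √(heron p q s x y z)
  have hsa := Real.sqrt_pos.2 ha
  have hsb := Real.sqrt_pos.2 hb
  have hsc := Real.sqrt_pos.2 hc
  have hqa := Real.sq_sqrt ha.le
  have hqb := Real.sq_sqrt hb.le
  have hqc := Real.sq_sqrt hc.le
  set A := cornerAngle p q s x y z with hA
  set B := cornerAngle q p s y x z with hB
  set C := cornerAngle s p q z x y with hC
  have hsin : 0 < Real.sin (A + B) := by
    rw [Real.sin_add, hsA, hcB, hcA, hsB]
    have : D / (√c * √b) * ((c + a - b) / (2 * √c * √a)) +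
        (c + b - a) / (2 * √c * √b) * (D / (√c * √a)) = D / (√a * √b) := by
      field_simp
      rw [hqc]; ring
    rw [this]
    positivity
  have hcos : Real.cos (A + B) = Real.cos (Real.pi - C) := by
    rw [Real.cos_pi_sub, Real.cos_add, hsA, hcB, hcA, hsB, hcC]
    field_simp
    rw [hD, hqc]
    linear_combination h4
  have hA0 : 0 ≤ A := Real.arccos_nonneg _
  have hB0 : 0 ≤ B := Real.arccos_nonneg _
  have hC0 : 0 ≤ C := Real.arccos_nonneg _
  have hA1 : A ≤ Real.pi := Real.arccos_le_pi _
  have hB1 : B ≤ Real.pi := Real.arccos_le_pi _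
  have hC1 : C ≤ Real.pi := Real.arccos_le_pi _
  have hAB : A + B ≤ Real.pi := by
    by_contra! hcon
    have h1 : Real.sin (A + B - Real.pi) = -Real.sin (A + B) := Real.sin_sub_pi _
    have h2 := Real.sin_nonneg_of_nonneg_of_le_pi (x := A + B - Real.pi) (by linarith)
      (by linarith)
    linarith
  have := Real.injOn_cos ⟨by linarith, hAB⟩ ⟨by linarith, by linarith⟩ hcos
  linarith

/-! ### Differentiating angles in logarithmic coordinates -/

section Deriv

variable {E : Type*} [NormedAddCommGroup E] [NormedSpace ℝ E]

/-- Here `a`, `b`, `c` are the squared side lengths and `H` is four times the squared area, so that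
`2 * √H` is four times the area. -/
lemma hasFDerivAt_arccos_lawOfCosines {a b c : E → ℝ} {a' b' c' : E →L[ℝ] ℝ} {u : E} {H : ℝ}
    (ha : HasFDerivAt a a' u) (hb : HasFDerivAt b b' u) (hc : HasFDerivAt c c' u)
    (hb0 : 0 < b u) (hc0 : 0 < c u) (hH0 : 0 < H)
    (hH : 4 * c u * b u - (c u + b u - a u) ^ 2 = 4 * H) :
    HasFDerivAt (fun v => Real.arccos ((c v + b v - a v) / (2 * √(c v) * √(b v))))
      ((1 / (2 * √H)) • (a' - ((a u + b u - c u) / (2 * b u)) • b' -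
        ((a u + c u - b u) / (2 * c u)) • c')) u := by
  have hsb := Real.sqrt_pos.2 hb0
  have hsc := Real.sqrt_pos.2 hc0
  have hsH := Real.sqrt_pos.2 hH0
  have hqb := Real.sq_sqrt hb0.le
  have hqc := Real.sq_sqrt hc0.le
  have harg : 1 - ((c u + b u - a u) / (2 * √(c u) * √(b u))) ^ 2 = H / (c u * b u) := by
    rw [div_pow, mul_pow, mul_pow, hqb, hqc]
    field_simp
    linarith
  have hpos : 0 < H / (c u * b u) := by positivity
  have hne1 : (c u + b u - a u) / (2 * √(c u) * √(b u)) ≠ -1 := by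
    intro h; rw [h] at harg; norm_num at harg; linarith
  have hne2 : (c u + b u - a u) / (2 * √(c u) * √(b u)) ≠ 1 := by
    intro h; rw [h] at harg; norm_num at harg; linarith
  have hN := (hc.add hb).sub ha
  have hM := ((hc.sqrt hc0.ne').const_mul 2).mul (hb.sqrt hb0.ne')
  have hM0 : 2 * √(c u) * √(b u) ≠ 0 := by positivity
  have hq := hN.mul ((hasDerivAt_inv hM0).comp_hasFDerivAt u hM)
  have := HasDerivAt.comp_hasFDerivAt u (h₂ := Real.arccos)
    (f := fun v => (c v + b v - a v) / (2 * √(c v) * √(b v)))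
    (Real.hasDerivAt_arccos hne1 hne2) hq
  refine this.congr_fderiv ?_
  ext v
  simp only [harg, Pi.add_apply, Pi.sub_apply, Pi.mul_apply, Function.comp_apply, smul_apply,
    sub_apply, add_apply, smul_eq_mul]
  rw [Real.sqrt_div' _ (by positivity), Real.sqrt_mul hc0.le]
  generalize a' v = A
  generalize b' v = B
  generalize c' v = C
  generalize √H = D at *
  set β := √(b u)
  set γ := √(c u)
  rw [← hqb, ← hqc]
  field_simp
  ring

lemma hasFDerivAt_sqLen_exp {f g : E → ℝ} {f' g' : E →L[ℝ] ℝ} {u : E} (z : ℝ)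
    (hf : HasFDerivAt f f' u) (hg : HasFDerivAt g g' u) :
    HasFDerivAt (fun v => sqLen (Real.exp (f v)) (Real.exp (g v)) z)
      ((2 * Real.exp (f u) * (Real.exp (f u) + Real.exp (g u) * z)) • f' +
        (2 * Real.exp (g u) * (Real.exp (g u) + Real.exp (f u) * z)) • g') u := by
  have h := ((hf.exp.pow 2).add (hg.exp.pow 2)).add
    (((hf.exp.const_mul 2).mul hg.exp).mul_const z)
  refine h.congr_fderiv ?_
  ext v
  simp
  ring

/-- The angle is invariant under a common scaling of the radii, so its derivative involves only
differences of logarithmic radii. -/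
lemma hasFDerivAt_cornerAngle_exp {f g h : E → ℝ} {f' g' h' : E →L[ℝ] ℝ} {u : E} {x y z : ℝ}
    (hf : HasFDerivAt f f' u) (hg : HasFDerivAt g g' u) (hh : HasFDerivAt h h' u)
    (hx : x ∈ Set.Icc (0 : ℝ) 1) (hy : y ∈ Set.Icc (0 : ℝ) 1) (hz : z ∈ Set.Icc (0 : ℝ) 1) :
    HasFDerivAt
      (fun v => cornerAngle (Real.exp (f v)) (Real.exp (g v)) (Real.exp (h v)) x y z)
      (cornerWeight (Real.exp (f u)) (Real.exp (g u)) (Real.exp (h u)) x y z • (g' - f') +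
        cornerWeight (Real.exp (f u)) (Real.exp (h u)) (Real.exp (g u)) x z y • (h' - f')) u := by
  have hp := Real.exp_pos (f u)
  have hq := Real.exp_pos (g u)
  have hs := Real.exp_pos (h u)
  have hH := heron_pos hp hq hs hx hy hz
  have hb := sqLen_pos hp hs hy.1
  have hc := sqLen_pos hp hq hz.1
  have := hasFDerivAt_arccos_lawOfCosines (hasFDerivAt_sqLen_exp x hg hh)
    (hasFDerivAt_sqLen_exp y hf hh) (hasFDerivAt_sqLen_exp z hf hg) hb hc hH
    (four_mul_sqLen_mul_sqLen _ _ _ _ _ _)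
  refine this.congr_fderiv ?_
  ext v
  simp only [smul_apply, sub_apply,
    add_apply, smul_eq_mul, cornerWeight]
  rw [heron_swap' (Real.exp (f u)) (Real.exp (h u))]
  have hsH := Real.sqrt_pos.2 hH
  generalize √(heron (Real.exp (f u)) (Real.exp (g u)) (Real.exp (h u)) x y z) = D at *
  generalize f' v = A
  generalize g' v = B
  generalize h' v = C
  generalize Real.exp (f u) = p at *
  generalize Real.exp (g u) = q at *
  generalize Real.exp (h u) = s at *
  field_simp
  unfold sqLen
  ring

lemma contDiff_cornerAngle_exp {f g h : E → ℝ} {x y z : ℝ} {n : WithTop ℕ∞}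
    (hf : ContDiff ℝ n f) (hg : ContDiff ℝ n g) (hh : ContDiff ℝ n h)
    (hx : x ∈ Set.Icc (0 : ℝ) 1) (hy : y ∈ Set.Icc (0 : ℝ) 1) (hz : z ∈ Set.Icc (0 : ℝ) 1) :
    ContDiff ℝ n
      (fun v => cornerAngle (Real.exp (f v)) (Real.exp (g v)) (Real.exp (h v)) x y z) := by
  have key : ∀ {k l : E → ℝ} (w : ℝ), ContDiff ℝ n k → ContDiff ℝ n l →
      ContDiff ℝ n (fun v => sqLen (Real.exp (k v)) (Real.exp (l v)) w) := by
    intro k l w hk hl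
    unfold sqLen
    exact ((hk.exp.pow 2).add (hl.exp.pow 2)).add
      (((contDiff_const.mul hk.exp).mul hl.exp).mul contDiff_const)
  have hpos : ∀ {k l : E → ℝ} {w : ℝ}, 0 ≤ w → ∀ v,
      0 < sqLen (Real.exp (k v)) (Real.exp (l v)) w :=
    fun hw v => sqLen_pos (Real.exp_pos _) (Real.exp_pos _) hw
  refine contDiff_iff_contDiffAt.2 fun v => ?_
  have hm := cornerAngle_arg_mem (hpos (k := f) (l := g) hz.1 v) (hpos (k := f) (l := h) hy.1 v)
    (heron_pos (Real.exp_pos (f v)) (Real.exp_pos (g v)) (Real.exp_pos (h v)) hx hy hz)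
  refine ContDiffAt.comp v (g := Real.arccos)
    (f := fun v => (sqLen (Real.exp (f v)) (Real.exp (g v)) z +
      sqLen (Real.exp (f v)) (Real.exp (h v)) y - sqLen (Real.exp (g v)) (Real.exp (h v)) x) /
      (2 * √(sqLen (Real.exp (f v)) (Real.exp (g v)) z) *
        √(sqLen (Real.exp (f v)) (Real.exp (h v)) y)))
    (Real.contDiffAt_arccos hm.1.ne' hm.2.ne) ?_
  refine ContDiff.contDiffAt ?_
  refine (((key z hf hg).add (key y hf hh)).sub (key x hg hh)).div
    ((contDiff_const.mul ((key z hf hg).sqrt fun v => (hpos hz.1 v).ne')).mul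
      ((key y hf hh).sqrt fun v => (hpos hy.1 v).ne')) fun v => ?_
  have h1 := Real.sqrt_pos.2 (hpos (k := f) (l := g) hz.1 v)
  have h2 := Real.sqrt_pos.2 (hpos (k := f) (l := h) hy.1 v)
  positivity

end Deriv

end AlphaFlow

end

noncomputable section

namespace AlphaFlow

variable {V : Type*}

lemma metricOf_pos (u : V → ℝ) (i : V) : 0 < metricOf u i := Real.exp_pos _

variable [DecidableEq V]

/-! ### The curvature map -/

/-- The derivative of the inner angle of the triangle `f` at `i` with respect to `u_j`,
for `j ≠ i`. -/
def angleWeight (Φ : Finset V → ℝ) (r : V → ℝ) (f : Finset V) (i j : V) : ℝ :=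
  ∑ k ∈ (f.erase i).erase j, cornerWeight (r i) (r j) (r k)
    (Real.cos (Φ {j, k})) (Real.cos (Φ {i, k})) (Real.cos (Φ {i, j}))

/-- The edges in `f` carry cosines in the unit interval. -/
def HasAcuteWeights (Φ : Finset V → ℝ) (f : Finset V) : Prop :=
  ∀ i ∈ f, ∀ j ∈ f, i ≠ j → Real.cos (Φ {i, j}) ∈ Set.Icc (0 : ℝ) 1

lemma edgeLength_pair_eq_sqrt_sqLen {Φ : Finset V → ℝ} {r : V → ℝ} {i j : V} (h : i ≠ j) :
    edgeLength Φ r {i, j} = √(sqLen (r i) (r j) (Real.cos (Φ {i, j}))) :=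
  edgeLength_pair Φ r h

lemma edgeLength_pair_sq {Φ : Finset V → ℝ} {r : V → ℝ} (hr : ∀ i, 0 < r i) {i j : V} (h : i ≠ j)
    (hc : 0 ≤ Real.cos (Φ {i, j})) :
    edgeLength Φ r {i, j} ^ 2 = sqLen (r i) (r j) (Real.cos (Φ {i, j})) := by
  rw [edgeLength_pair_eq_sqrt_sqLen h, Real.sq_sqrt (sqLen_pos (hr i) (hr j) hc).le]

lemma innerAngle_eq_cornerAngle {Φ : Finset V → ℝ} {r : V → ℝ} (hr : ∀ i, 0 < r i) {i j k : V}
    (hij : i ≠ j) (hik : i ≠ k) (hjk : j ≠ k) (hΦ : HasAcuteWeights Φ {i, j, k}) :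
    innerAngle Φ r {i, j, k} i = cornerAngle (r i) (r j) (r k)
      (Real.cos (Φ {j, k})) (Real.cos (Φ {i, k})) (Real.cos (Φ {i, j})) := by
  rw [innerAngle_triple Φ r hij hik hjk,
    edgeLength_pair_sq hr hij (hΦ i (by simp) j (by simp) hij).1,
    edgeLength_pair_sq hr hik (hΦ i (by simp) k (by simp) hik).1,
    edgeLength_pair_sq hr hjk (hΦ j (by simp) k (by simp) hjk).1,
    edgeLength_pair_eq_sqrt_sqLen hij, edgeLength_pair_eq_sqrt_sqLen hik, cornerAngle]

lemma exists_eq_triple_of_mem {f : Finset V} (hf : f.card = 3) {i : V} (hi : i ∈ f) :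
    ∃ j k, i ≠ j ∧ i ≠ k ∧ j ≠ k ∧ f = {i, j, k} := by
  have h : (f.erase i).card = 2 := by rw [Finset.card_erase_of_mem hi, hf]
  obtain ⟨j, k, hjk, he⟩ := Finset.card_eq_two.1 h
  refine ⟨j, k, ?_, ?_, hjk, ?_⟩
  · rintro rfl
    exact Finset.notMem_erase i f (by rw [he]; simp)
  · rintro rfl
    exact Finset.notMem_erase i f (by rw [he]; simp)
  · rw [← he, Finset.insert_erase hi]

lemma sum_innerAngle {Φ : Finset V → ℝ} {r : V → ℝ} (hr : ∀ i, 0 < r i) {f : Finset V}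
    (hf : f.card = 3) (hΦ : HasAcuteWeights Φ f) : ∑ i ∈ f, innerAngle Φ r f i = Real.pi := by
  obtain ⟨i, hi⟩ : f.Nonempty := Finset.card_pos.1 (by omega)
  obtain ⟨j, k, hij, hik, hjk, rfl⟩ := exists_eq_triple_of_mem hf hi
  have e1 : ({i, j, k} : Finset V) = {j, i, k} := Finset.insert_comm ..
  have e2 : ({i, j, k} : Finset V) = {k, i, j} := by
    rw [Finset.pair_comm j k, Finset.insert_comm]
  have hij' := hΦ i (by simp) j (by simp) hij
  have hik' := hΦ i (by simp) k (by simp) hik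
  have hjk' := hΦ j (by simp) k (by simp) hjk
  rw [Finset.sum_insert (by simp [hij, hik]), Finset.sum_pair hjk,
    innerAngle_eq_cornerAngle hr hij hik hjk hΦ, e1,
    innerAngle_eq_cornerAngle hr hij.symm hjk hik (e1 ▸ hΦ), ← e1, e2,
    innerAngle_eq_cornerAngle hr hik.symm hjk.symm hij (e2 ▸ hΦ), Finset.pair_comm j i,
    Finset.pair_comm k j, Finset.pair_comm k i, ← add_assoc]
  exact cornerAngle_add_add (hr i) (hr j) (hr k) hjk' hik' hij'

lemma contDiff_innerAngle [Fintype V] {Φ : Finset V → ℝ} {f : Finset V} (hf : f.card = 3)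
    (hΦ : HasAcuteWeights Φ f) {i : V} (hi : i ∈ f) {n : WithTop ℕ∞} :
    ContDiff ℝ n fun u : V → ℝ => innerAngle Φ (metricOf u) f i := by
  obtain ⟨j, k, hij, hik, hjk, rfl⟩ := exists_eq_triple_of_mem hf hi
  have : (fun u : V → ℝ => innerAngle Φ (metricOf u) {i, j, k} i) = fun u =>
      cornerAngle (Real.exp (u i)) (Real.exp (u j)) (Real.exp (u k))
      (Real.cos (Φ {j, k})) (Real.cos (Φ {i, k})) (Real.cos (Φ {i, j})) :=
    funext fun u => innerAngle_eq_cornerAngle (metricOf_pos u) hij hik hjk hΦ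
  rw [this]
  exact contDiff_cornerAngle_exp (contDiff_apply ℝ ℝ i) (contDiff_apply ℝ ℝ j)
    (contDiff_apply ℝ ℝ k) (hΦ j (by simp) k (by simp) hjk) (hΦ i (by simp) k (by simp) hik)
    (hΦ i (by simp) j (by simp) hij)

lemma angleWeight_triple (Φ : Finset V → ℝ) (r : V → ℝ) {i j k : V}
    (hij : i ≠ j) (hik : i ≠ k) (hjk : j ≠ k) :
    angleWeight Φ r {i, j, k} i j = cornerWeight (r i) (r j) (r k)
      (Real.cos (Φ {j, k})) (Real.cos (Φ {i, k})) (Real.cos (Φ {i, j})) := by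
  rw [angleWeight, Finset.erase_insert (by simp [hij, hik]), Finset.erase_insert (by simp [hjk]),
    Finset.sum_singleton]

/-- This reciprocity of the angle derivatives is what makes the Jacobian of the curvature symmetric,
and in the end the `α`-form closed. -/
lemma angleWeight_comm (Φ : Finset V → ℝ) (r : V → ℝ) (f : Finset V) (i j : V) :
    angleWeight Φ r f i j = angleWeight Φ r f j i := by
  rw [angleWeight, angleWeight, Finset.erase_right_comm]
  refine Finset.sum_congr rfl fun k _ => ?_
  rw [cornerWeight_swap, Finset.pair_comm i j]

lemma hasFDerivAt_innerAngle [Fintype V] {Φ : Finset V → ℝ} {f : Finset V} (hf : f.card = 3)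
    (hΦ : HasAcuteWeights Φ f) {i : V} (hi : i ∈ f) (u : V → ℝ) :
    HasFDerivAt (fun u : V → ℝ => innerAngle Φ (metricOf u) f i)
      (∑ j ∈ f.erase i, angleWeight Φ (metricOf u) f i j •
        (ContinuousLinearMap.proj (R := ℝ) (φ := fun _ : V => ℝ) j -
          ContinuousLinearMap.proj i)) u := by
  obtain ⟨j, k, hij, hik, hjk, rfl⟩ := exists_eq_triple_of_mem hf hi
  have : (fun u : V → ℝ => innerAngle Φ (metricOf u) {i, j, k} i) = fun u =>
      cornerAngle (Real.exp (u i)) (Real.exp (u j)) (Real.exp (u k))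
      (Real.cos (Φ {j, k})) (Real.cos (Φ {i, k})) (Real.cos (Φ {i, j})) :=
    funext fun u => innerAngle_eq_cornerAngle (metricOf_pos u) hij hik hjk hΦ
  rw [this, Finset.erase_insert (by simp [hij, hik]), Finset.sum_pair hjk,
    angleWeight_triple Φ _ hij hik hjk, Finset.pair_comm j k,
    angleWeight_triple Φ _ hik hij hjk.symm, Finset.pair_comm k j]
  exact hasFDerivAt_cornerAngle_exp (hasFDerivAt_apply i u) (hasFDerivAt_apply j u)
    (hasFDerivAt_apply k u) (hΦ j (by simp) k (by simp) hjk) (hΦ i (by simp) k (by simp) hik)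
    (hΦ i (by simp) j (by simp) hij)

lemma angleWeight_nonneg {Φ : Finset V → ℝ} {r : V → ℝ} (hr : ∀ i, 0 < r i) {f : Finset V}
    (hΦ : HasAcuteWeights Φ f) {i j : V} (hi : i ∈ f) (hj : j ∈ f) (hij : i ≠ j) :
    0 ≤ angleWeight Φ r f i j := by
  refine Finset.sum_nonneg fun k hk => ?_
  simp only [Finset.mem_erase] at hk
  exact cornerWeight_nonneg (hr i) (hr j) (hr k) (hΦ j hj k hk.2.2 hk.1.symm).1
    (hΦ i hi k hk.2.2 hk.2.1.symm).1 (hΦ i hi j hj hij)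

/-- The quadratic form of the angle derivatives in a triangle vanishes only on vectors that are
constant on the triangle. -/
lemma eq_of_sum_angleWeight_eq_zero {Φ : Finset V → ℝ} {r : V → ℝ} (hr : ∀ i, 0 < r i)
    {f : Finset V} (hf : f.card = 3) (hΦ : HasAcuteWeights Φ f) {v : V → ℝ}
    (h : ∑ i ∈ f, ∑ j ∈ f.erase i, angleWeight Φ r f i j * (v i - v j) ^ 2 = 0)
    {i j : V} (hi : i ∈ f) (hj : j ∈ f) : v i = v j := by
  have hterm : ∀ i ∈ f, ∀ j ∈ f, i ≠ j → angleWeight Φ r f i j * (v i - v j) ^ 2 = 0 := by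
    have hnn : ∀ i ∈ f, ∀ j ∈ f.erase i, 0 ≤ angleWeight Φ r f i j * (v i - v j) ^ 2 :=
      fun i hi j hj => mul_nonneg (angleWeight_nonneg hr hΦ hi (Finset.mem_of_mem_erase hj)
        (Finset.ne_of_mem_erase hj).symm) (sq_nonneg _)
    intro i hi j hj hij
    have h1 := (Finset.sum_eq_zero_iff_of_nonneg
      fun i hi => Finset.sum_nonneg (hnn i hi)).1 h i hi
    exact (Finset.sum_eq_zero_iff_of_nonneg (hnn i hi)).1 h1 j
      (Finset.mem_erase.2 ⟨hij.symm, hj⟩)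
  rcases eq_or_ne i j with rfl | hij
  · rfl
  obtain ⟨k, hik, hjk, rfl⟩ : ∃ k, i ≠ k ∧ j ≠ k ∧ f = {i, j, k} := by
    have hj2 : j ∈ f.erase i := Finset.mem_erase.2 ⟨hij.symm, hj⟩
    obtain ⟨k, hk⟩ := Finset.card_eq_one.1
      (show ((f.erase i).erase j).card = 1 by
        rw [Finset.card_erase_of_mem hj2, Finset.card_erase_of_mem hi, hf])
    have hk' : k ∈ (f.erase i).erase j := by simp [hk]
    simp only [Finset.mem_erase] at hk'
    refine ⟨k, hk'.2.1.symm, hk'.1.symm, ?_⟩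
    rw [← hk, Finset.insert_erase hj2, Finset.insert_erase hi]
  have hij' := hΦ i (by simp) j (by simp) hij
  have hik' := hΦ i (by simp) k (by simp) hik
  have hjk' := hΦ j (by simp) k (by simp) hjk
  have e0 : ∀ {a b : V} {w : ℝ}, 0 < w → w * (v a - v b) ^ 2 = 0 → v a = v b := by
    intro a b w hw h
    have := (mul_eq_zero.1 h).resolve_left hw.ne'
    exact sub_eq_zero.1 (pow_eq_zero_iff (two_ne_zero) |>.1 this)
  have hij0 := hterm i (by simp) j (by simp) hij
  rw [angleWeight_triple Φ r hij hik hjk] at hij0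
  -- If the weight of `{i, j}` degenerates, the cosines of the other two edges are `0`, so their
  -- weights are positive and the values at `i` and `j` both equal the one at `k`.
  by_cases hdeg : Real.cos (Φ {i, j}) < 1 ∨ 0 < Real.cos (Φ {j, k}) ∨ 0 < Real.cos (Φ {i, k})
  · exact e0 (cornerWeight_pos (hr i) (hr j) (hr k) hjk' hik' hij' hdeg) hij0
  · push Not at hdeg
    have e2 : ({i, j, k} : Finset V) = {i, k, j} := by rw [Finset.pair_comm]
    have e3 : ({i, j, k} : Finset V) = {j, k, i} := by
      rw [Finset.insert_comm, Finset.pair_comm i k]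
    have hik0 := hterm i (by simp) k (by simp) hik
    have hjk0 := hterm j (by simp) k (by simp) hjk
    rw [e2, angleWeight_triple Φ r hik hij hjk.symm, Finset.pair_comm k j] at hik0
    rw [e3, angleWeight_triple Φ r hjk hij.symm hik.symm, Finset.pair_comm k i,
      Finset.pair_comm j i] at hjk0
    have h1 := e0 (cornerWeight_pos (hr i) (hr k) (hr j) hjk' hij' hik'
      (Or.inl (by linarith [hdeg.2.2]))) hik0
    have h2 := e0 (cornerWeight_pos (hr j) (hr k) (hr i) hik' hij' hjk'
      (Or.inl (by linarith [hdeg.2.1]))) hjk0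
    rw [h1, h2]

end AlphaFlow

end

noncomputable section

namespace AlphaFlow

variable {V : Type*} [Fintype V]

/-! ### Gauss–Bonnet and the Jacobian of the curvature -/

lemma mem_simplices {T : AbstractSimplicialComplex V} {n : ℕ} {s : Finset V} :
    s ∈ simplices T n ↔ s ∈ T ∧ s.card = n + 1 := by
  simp [simplices]

lemma card_of_mem_triangles {T : AbstractSimplicialComplex V} {f : Finset V}
    (hf : f ∈ triangles T) : f.card = 3 :=
  (mem_simplices.1 hf).2

lemma mem_edges_of_subset_triangle {T : AbstractSimplicialComplex V} {e f : Finset V}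
    (hf : f ∈ triangles T) (hef : e ⊆ f) (he : e.card = 2) : e ∈ edges T := by
  refine mem_simplices.2 ⟨?_, he⟩
  exact (T.isRelLowerSet_faces (mem_simplices.1 hf).1).2 hef (Finset.card_pos.1 (by omega))

variable [DecidableEq V]

lemma hasAcuteWeights_of_mem_triangles {T : AbstractSimplicialComplex V} {Φ : Finset V → ℝ}
    (hΦ : ∀ e ∈ edges T, Φ e ∈ Set.Icc 0 (Real.pi / 2)) {f : Finset V} (hf : f ∈ triangles T) :
    HasAcuteWeights Φ f := by
  intro i hi j hj hij
  have h := hΦ _ (mem_edges_of_subset_triangle hf (Finset.insert_subset hi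
    (Finset.singleton_subset_iff.2 hj)) (Finset.card_pair hij))
  exact ⟨Real.cos_nonneg_of_neg_pi_div_two_le_of_le (by linarith [h.1, Real.pi_pos]) h.2,
    Real.cos_le_one _⟩

/-- Incidences of edges with triangles are counted twice: two triangles at each edge, three edges in
each triangle. -/
lemma two_mul_card_edges {T : AbstractSimplicialComplex V} (hT : IsClosedSurface T) :
    2 * (edges T).card = 3 * (triangles T).card := by
  have h := Finset.sum_card_bipartiteAbove_eq_sum_card_bipartiteBelow
    (s := edges T) (t := triangles T) (fun e f => e ⊆ f)
  have h1 : ∀ e ∈ edges T, (Finset.bipartiteAbove (fun e f => e ⊆ f) (triangles T) e).card = 2 :=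
    fun e he => hT.card_triangles e he
  have h2 : ∀ f ∈ triangles T,
      (Finset.bipartiteBelow (fun e f => e ⊆ f) (edges T) f).card = 3 := by
    intro f hf
    have : Finset.bipartiteBelow (fun e f => e ⊆ f) (edges T) f = f.powersetCard 2 := by
      ext e
      simp only [Finset.mem_bipartiteBelow, Finset.mem_powersetCard]
      exact ⟨fun h => ⟨h.2, (mem_simplices.1 h.1).2⟩,
        fun h => ⟨mem_edges_of_subset_triangle hf h.1 h.2, h.1⟩⟩
    rw [this, Finset.card_powersetCard, card_of_mem_triangles hf]
    rfl
  rw [Finset.sum_congr rfl h1, Finset.sum_congr rfl h2] at h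
  simpa [mul_comm] using h

lemma sum_sum_filter_mem_triangles (T : AbstractSimplicialComplex V) (g : Finset V → V → ℝ) :
    ∑ i, ∑ f ∈ (triangles T).filter (fun f => i ∈ f), g f i =
      ∑ f ∈ triangles T, ∑ i ∈ f, g f i := by
  simp_rw [Finset.sum_filter]
  rw [Finset.sum_comm]
  refine Finset.sum_congr rfl fun f _ => ?_
  rw [← Finset.sum_filter]
  simp

/-- The combinatorial Gauss–Bonnet formula. -/
lemma sum_gaussCurv {T : AbstractSimplicialComplex V} (hT : IsClosedSurface T)
    {Φ : Finset V → ℝ} (hΦ : ∀ e ∈ edges T, Φ e ∈ Set.Icc 0 (Real.pi / 2))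
    {r : V → ℝ} (hr : ∀ i, 0 < r i) :
    ∑ i, gaussCurv T Φ r i = 2 * Real.pi * eulerChar T := by
  have h : (2 : ℝ) * (edges T).card = 3 * (triangles T).card := by
    exact_mod_cast two_mul_card_edges hT
  have hsum : ∑ f ∈ triangles T, ∑ i ∈ f, innerAngle Φ r f i =
      (triangles T).card * Real.pi := by
    rw [Finset.sum_congr rfl fun f hf => sum_innerAngle hr (card_of_mem_triangles hf)
      (hasAcuteWeights_of_mem_triangles hΦ hf)]
    simp
  simp only [gaussCurv]
  rw [Finset.sum_sub_distrib, sum_sum_filter_mem_triangles, hsum, eulerChar]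
  push_cast
  simp only [Finset.sum_const, Finset.card_univ, nsmul_eq_mul]
  linear_combination Real.pi * h

lemma abs_gaussCurv_le (T : AbstractSimplicialComplex V) (Φ : Finset V → ℝ) (r : V → ℝ) (i : V) :
    |gaussCurv T Φ r i| ≤ 2 * Real.pi + (triangles T).card * Real.pi := by
  have h0 : 0 ≤ ∑ f ∈ (triangles T).filter fun f => i ∈ f, innerAngle Φ r f i :=
    Finset.sum_nonneg fun f _ => Real.arccos_nonneg _
  have h1 : ∑ f ∈ (triangles T).filter fun f => i ∈ f, innerAngle Φ r f i ≤
      (triangles T).card * Real.pi :=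
    calc _ ≤ ∑ f ∈ (triangles T).filter fun f => i ∈ f, Real.pi :=
          Finset.sum_le_sum fun f _ => Real.arccos_le_pi _
      _ = ((triangles T).filter fun f => i ∈ f).card * Real.pi := by simp
      _ ≤ (triangles T).card * Real.pi := by
          have := Real.pi_pos
          gcongr
          exact Finset.filter_subset _ _
  have := Real.pi_pos
  rw [gaussCurv, abs_le]
  constructor <;> linarith

variable {T : AbstractSimplicialComplex V} {Φ : Finset V → ℝ}

lemma contDiff_gaussCurv (hΦ : ∀ e ∈ edges T, Φ e ∈ Set.Icc 0 (Real.pi / 2)) (i : V)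
    {n : WithTop ℕ∞} : ContDiff ℝ n fun u : V → ℝ => gaussCurv T Φ (metricOf u) i := by
  refine contDiff_const.sub (ContDiff.sum fun f hf => ?_)
  rw [Finset.mem_filter] at hf
  exact contDiff_innerAngle (card_of_mem_triangles hf.1)
    (hasAcuteWeights_of_mem_triangles hΦ hf.1) hf.2

lemma fderiv_gaussCurv (hΦ : ∀ e ∈ edges T, Φ e ∈ Set.Icc 0 (Real.pi / 2)) (u : V → ℝ) (i : V)
    (v : V → ℝ) :
    fderiv ℝ (fun u : V → ℝ => gaussCurv T Φ (metricOf u) i) u v =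
      ∑ f ∈ (triangles T).filter (fun f => i ∈ f),
        ∑ j ∈ f.erase i, angleWeight Φ (metricOf u) f i j * (v i - v j) := by
  have h : HasFDerivAt (fun u : V → ℝ => gaussCurv T Φ (metricOf u) i) _ u :=
    (HasFDerivAt.fun_sum (u := (triangles T).filter (fun f => i ∈ f)) fun f hf =>
      hasFDerivAt_innerAngle (card_of_mem_triangles (Finset.mem_filter.1 hf).1)
        (hasAcuteWeights_of_mem_triangles hΦ (Finset.mem_filter.1 hf).1)
        (Finset.mem_filter.1 hf).2 u).const_sub (2 * Real.pi)
  rw [h.fderiv]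
  simp only [neg_apply, sum_apply, smul_apply, sub_apply,
    ContinuousLinearMap.proj_apply, smul_eq_mul, ← Finset.sum_neg_distrib]
  refine Finset.sum_congr rfl fun f _ => Finset.sum_congr rfl fun j _ => by ring

/-- The Dirichlet form of the Jacobian of the curvature map. -/
def dirichletForm (T : AbstractSimplicialComplex V) (Φ : Finset V → ℝ) (r v w : V → ℝ) : ℝ :=
  2⁻¹ * ∑ f ∈ triangles T, ∑ i ∈ f, ∑ j ∈ f.erase i,
    angleWeight Φ r f i j * ((v i - v j) * (w i - w j))

lemma dirichletForm_comm (r v w : V → ℝ) : dirichletForm T Φ r v w = dirichletForm T Φ r w v := by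
  simp only [dirichletForm, mul_comm (v _ - v _)]

/-- Summation by parts inside each triangle: exchanging `i` and `j` preserves the weight and changes
the sign of `w i - w j`. -/
lemma sum_mul_fderiv_gaussCurv (hΦ : ∀ e ∈ edges T, Φ e ∈ Set.Icc 0 (Real.pi / 2))
    (u v w : V → ℝ) :
    ∑ i, v i * fderiv ℝ (fun u : V → ℝ => gaussCurv T Φ (metricOf u) i) u w =
      dirichletForm T Φ (metricOf u) v w := by
  simp_rw [fderiv_gaussCurv hΦ, Finset.mul_sum (s := Finset.filter _ _)]
  rw [sum_sum_filter_mem_triangles T fun f i =>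
    v i * ∑ j ∈ f.erase i, angleWeight Φ (metricOf u) f i j * (w i - w j), dirichletForm,
    Finset.mul_sum]
  refine Finset.sum_congr rfl fun f _ => ?_
  have hswap : ∑ i ∈ f, ∑ j ∈ f.erase i, angleWeight Φ (metricOf u) f i j * (v j * (w i - w j)) =
      -∑ i ∈ f, ∑ j ∈ f.erase i, angleWeight Φ (metricOf u) f i j * (v i * (w i - w j)) := by
    rw [Finset.sum_comm' (t' := f) (s' := fun j => f.erase j), ← Finset.sum_neg_distrib]
    · refine Finset.sum_congr rfl fun i _ => ?_
      rw [← Finset.sum_neg_distrib]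
      refine Finset.sum_congr rfl fun j _ => ?_
      rw [angleWeight_comm]; ring
    · intro i j
      simp only [Finset.mem_erase]
      tauto
  have hsplit : ∑ i ∈ f, ∑ j ∈ f.erase i,
      angleWeight Φ (metricOf u) f i j * ((v i - v j) * (w i - w j)) =
      ∑ i ∈ f, ∑ j ∈ f.erase i, angleWeight Φ (metricOf u) f i j * (v i * (w i - w j)) -
      ∑ i ∈ f, ∑ j ∈ f.erase i, angleWeight Φ (metricOf u) f i j * (v j * (w i - w j)) := by
    simp only [← Finset.sum_sub_distrib]
    refine Finset.sum_congr rfl fun i _ => Finset.sum_congr rfl fun j _ => by ring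
  rw [hsplit, hswap]
  simp only [Finset.mul_sum]
  rw [sub_neg_eq_add, ← two_mul, inv_mul_cancel_left₀ two_ne_zero]
  refine Finset.sum_congr rfl fun i _ => Finset.sum_congr rfl fun j _ => by ring

lemma dirichletForm_self_nonneg (hΦ : ∀ e ∈ edges T, Φ e ∈ Set.Icc 0 (Real.pi / 2))
    {r : V → ℝ} (hr : ∀ i, 0 < r i) (v : V → ℝ) : 0 ≤ dirichletForm T Φ r v v :=
  mul_nonneg (by norm_num) <| Finset.sum_nonneg fun _ hf => Finset.sum_nonneg fun _ hi =>
    Finset.sum_nonneg fun _ hj => mul_nonneg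
      (angleWeight_nonneg hr (hasAcuteWeights_of_mem_triangles hΦ hf) hi
        (Finset.mem_of_mem_erase hj) (Finset.ne_of_mem_erase hj).symm) (mul_self_nonneg _)

/-- The form is a sum of nonnegative contributions of triangles, so `v` is constant on each
triangle. Every edge lies in a triangle and the 1-skeleton is connected. -/
lemma eq_of_dirichletForm_self_eq_zero (hT : IsClosedSurface T)
    (hΦ : ∀ e ∈ edges T, Φ e ∈ Set.Icc 0 (Real.pi / 2))
    {r : V → ℝ} (hr : ∀ i, 0 < r i) {v : V → ℝ} (h : dirichletForm T Φ r v v = 0) (i j : V) :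
    v i = v j := by
  have h0 := (mul_eq_zero.1 h).resolve_left (by norm_num)
  have hface := (Finset.sum_eq_zero_iff_of_nonneg fun f hf => Finset.sum_nonneg fun i hi =>
    Finset.sum_nonneg fun j hj => mul_nonneg
      (angleWeight_nonneg hr (hasAcuteWeights_of_mem_triangles hΦ hf) hi
        (Finset.mem_of_mem_erase hj) (Finset.ne_of_mem_erase hj).symm) (mul_self_nonneg _)).1 h0
  have hadj : ∀ i j, (oneSkeleton T).Adj i j → v i = v j := by
    intro i j hij
    obtain ⟨f, hf, hsub⟩ := hT.exists_triangle _ (mem_simplices.1 hij.2).1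
    refine eq_of_sum_angleWeight_eq_zero hr (card_of_mem_triangles hf)
      (hasAcuteWeights_of_mem_triangles hΦ hf) ?_ (hsub (by simp)) (hsub (by simp))
    simpa only [sq] using hface f hf
  obtain ⟨p⟩ := hT.connected.preconnected i j
  induction p with
  | nil => rfl
  | cons hab _ ih => exact (hadj _ _ hab).trans ih

lemma dirichletForm_add_const (r v w : V → ℝ) (c : ℝ) :
    dirichletForm T Φ r (fun i => v i + c) w = dirichletForm T Φ r v w := by
  simp [dirichletForm]

end AlphaFlow

end

noncomputable section

namespace AlphaFlow

variable {V : Type*}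

/-! ### The term `s_α r_i ^ α` in logarithmic coordinates -/

lemma metricOf_rpow (u : V → ℝ) (i : V) (α : ℝ) : metricOf u i ^ α = Real.exp (α * u i) := by
  rw [metricOf, ← Real.exp_mul, mul_comm]

variable [Fintype V]

lemma sum_metricOf_rpow_pos [Nonempty V] {α : ℝ} (u : V → ℝ) : 0 < ∑ i, metricOf u i ^ α :=
  Finset.sum_pos (fun i _ => Real.rpow_pos_of_pos (metricOf_pos u i) α) Finset.univ_nonempty

lemma hasFDerivAt_sAlpha_mul_rpow [Nonempty V] {T : AbstractSimplicialComplex V} {α : ℝ} (u : V → ℝ) (i : V) :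
    HasFDerivAt (fun u => sAlpha T α (metricOf u) * metricOf u i ^ α)
      ((α * sAlpha T α (metricOf u) * metricOf u i ^ α) •
        (ContinuousLinearMap.proj (R := ℝ) (φ := fun _ : V => ℝ) i -
          (∑ j, metricOf u j ^ α)⁻¹ • ∑ j, metricOf u j ^ α • ContinuousLinearMap.proj j)) u := by
  have hexp : ∀ j, HasFDerivAt (fun u : V → ℝ => metricOf u j ^ α)
      ((α * metricOf u j ^ α) • ContinuousLinearMap.proj (R := ℝ) (φ := fun _ : V => ℝ) j) u := by
    intro j
    simp only [metricOf_rpow]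
    refine ((hasFDerivAt_apply (𝕜 := ℝ) j u).const_mul α).exp.congr_fderiv ?_
    ext w; simp; ring
  have hS0 := (sum_metricOf_rpow_pos (α := α) u).ne'
  have hS := HasFDerivAt.fun_sum (u := Finset.univ) fun j _ => hexp j
  have h := (((hasDerivAt_inv hS0).comp_hasFDerivAt u hS).const_mul
    (2 * Real.pi * (eulerChar T : ℝ))).mul (hexp i)
  refine h.congr_fderiv ?_
  ext w
  simp only [sAlpha, add_apply, smul_apply, sub_apply, sum_apply, smul_eq_mul, mul_assoc,
    Function.comp_apply, ← Finset.mul_sum, ContinuousLinearMap.proj_apply]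
  field_simp
  ring

variable [DecidableEq V]

/-! ### The spectral gap -/

open Matrix in
-- Orthonormality is recorded only through Parseval's identity, stated for plain functions and the
-- dot product.
lemma exists_orthonormal_eigenvectors (A : Matrix V V ℝ) (hA : A.IsHermitian) :
    ∃ (e : V → V → ℝ) (l : V → ℝ), (∀ k, A *ᵥ e k = l k • e k) ∧ (∀ k, e k ≠ 0) ∧
      ∀ x y : V → ℝ, ∑ k, (x ⬝ᵥ e k) * (e k ⬝ᵥ y) = x ⬝ᵥ y := by
  refine ⟨fun k => ⇑(hA.eigenvectorBasis k), hA.eigenvalues,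
    fun k => hA.mulVec_eigenvectorBasis k, fun k h => ?_, fun x y => ?_⟩
  · have h1 := hA.eigenvectorBasis.orthonormal.ne_zero k
    exact h1 (by ext i; exact congrFun h i)
  · have := hA.eigenvectorBasis.sum_inner_mul_inner (WithLp.toLp 2 x) (WithLp.toLp 2 y)
    simpa [EuclideanSpace.inner_eq_star_dotProduct, dotProduct_comm] using this

lemma firstPosEigenvalue_le {A : Matrix V V ℝ} {l : ℝ} (hl : 0 < l) {g : V → ℝ} (hg : g ≠ 0)
    (h : A.mulVec g = l • g) : firstPosEigenvalue A ≤ l := by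
  refine csInf_le ⟨0, fun x hx => hx.1.le⟩ ⟨hl, ?_⟩
  exact Module.End.hasEigenvalue_of_hasEigenvector (x := g)
    ⟨Module.End.mem_eigenspace_iff.2 (by simpa using h), hg⟩

/-- The variational characterization of the first positive eigenvalue of the operator `m⁻¹ L`,
where `L` is symmetric, and positive definite modulo constants. -/
lemma mul_sum_lt_of_lt_firstPosEigenvalue {L : Matrix V V ℝ} (hL : ∀ i j, L i j = L j i)
    (hker : ∀ v : V → ℝ, ∑ i, v i * ∑ j, L i j * v j ≤ 0 → ∃ a, ∀ i, v i = a)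
    {m : V → ℝ} (hm : ∀ i, 0 < m i) {c : ℝ}
    (hc : c < firstPosEigenvalue (Matrix.of fun i j => 1 / m i * L i j))
    {w : V → ℝ} (hw : w ≠ 0) (hmw : ∑ i, m i * w i = 0) :
    c * ∑ i, m i * w i ^ 2 < ∑ i, w i * ∑ j, L i j * w j := by
  set d : V → ℝ := fun i => √(m i) with hd
  have hd0 : ∀ i, 0 < d i := fun i => Real.sqrt_pos.2 (hm i)
  have hdd : ∀ i, d i ^ 2 = m i := fun i => Real.sq_sqrt (hm i).le
  -- With `m = d²`, the matrix `m⁻¹ L` is similar to the symmetric `d⁻¹ L d⁻¹`; eigenvectors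
  -- correspond by `e ↦ e / d`, and `w` corresponds to `y = d w`.
  set A : Matrix V V ℝ := Matrix.of fun i j => L i j / (d i * d j) with hA
  have hAH : A.IsHermitian := by
    ext i j
    simp [hA, hL j i, mul_comm (d j)]
  obtain ⟨e, l, hel, he0, hpars⟩ := exists_orthonormal_eigenvectors A hAH
  set y : V → ℝ := fun i => d i * w i with hy
  have hyy : y ⬝ᵥ y = ∑ i, m i * w i ^ 2 := by
    refine Finset.sum_congr rfl fun i _ => ?_
    simp only [hy, ← hdd]; ring
  have hAmul : ∀ x : V → ℝ, ∀ i, (A.mulVec x) i = (∑ j, L i j * (x j / d j)) / d i := by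
    intro x i
    rw [Matrix.mulVec, dotProduct, Finset.sum_div]
    refine Finset.sum_congr rfl fun j _ => ?_
    have := (hd0 i).ne'
    have := (hd0 j).ne'
    simp only [hA, Matrix.of_apply]
    field_simp
  have hyAy : y ⬝ᵥ A.mulVec y = ∑ i, w i * ∑ j, L i j * w j := by
    refine Finset.sum_congr rfl fun i _ => ?_
    have := (hd0 i).ne'
    rw [hAmul]
    have : ∀ j, y j / d j = w j := fun j => by
      have := (hd0 j).ne'
      simp only [hy]; field_simp
    simp only [this]
    simp only [hy]
    field_simp
  -- If `l k ≤ 0`, then `e k / d` is constant by `hker`, so `e k` is a multiple of `d` and is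
  -- orthogonal to `y` since `w` has weighted mean zero. If `l k > 0`, then `l k` is a positive
  -- eigenvalue of `m⁻¹ L`.
  have hle : ∀ k, (c < l k) ∨ (y ⬝ᵥ e k = 0) := by
    intro k
    have hg : ∀ i, ∑ j, L i j * (e k j / d j) = d i * (l k * e k i) := by
      intro i
      have := congrFun (hel k) i
      rw [hAmul, div_eq_iff (hd0 i).ne'] at this
      rw [this]; simp [mul_comm]
    rcases le_or_gt (l k) 0 with hk | hk
    · right
      obtain ⟨a, ha⟩ := hker (fun i => e k i / d i) (by
        simp only [hg]
        refine Finset.sum_nonpos fun i _ => ?_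
        have : e k i / d i * (d i * (l k * e k i)) = l k * (e k i) ^ 2 := by
          have := (hd0 i).ne'
          field_simp
        rw [this]
        exact mul_nonpos_of_nonpos_of_nonneg hk (sq_nonneg _))
      have hterm : ∀ i, y i * e k i = a * (m i * w i) := by
        intro i
        have h1 : e k i = a * d i := by
          have := ha i
          rwa [div_eq_iff (hd0 i).ne'] at this
        rw [h1, ← hdd]; simp only [hy]; ring
      rw [dotProduct]
      simp only [hterm]
      rw [← Finset.mul_sum, hmw, mul_zero]
    · left
      refine hc.trans_le (firstPosEigenvalue_le hk (g := fun i => e k i / d i) ?_ ?_)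
      · intro h
        refine he0 k (funext fun i => ?_)
        have := congrFun h i
        simpa [(hd0 i).ne'] using this
      · ext i
        have := (hd0 i).ne'
        have h1 : ∀ j, 1 / m i * L i j * (e k j / d j) = 1 / m i * (L i j * (e k j / d j)) :=
          fun j => by ring
        simp only [Matrix.mulVec, dotProduct, Matrix.of_apply, h1]
        rw [← Finset.mul_sum, hg, ← hdd]
        simp only [Pi.smul_apply, smul_eq_mul]
        field_simp
  have hy0 : ∃ k, y ⬝ᵥ e k ≠ 0 := by
    by_contra! hcon
    have h0 : y ⬝ᵥ y = 0 := by rw [← hpars]; simp [hcon]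
    refine hw (funext fun i => ?_)
    have := congrFun (dotProduct_self_eq_zero.1 h0) i
    simpa [hy, (hd0 i).ne'] using this
  have hsym : ∀ k, e k ⬝ᵥ A.mulVec y = l k * (e k ⬝ᵥ y) := by
    intro k
    have hAt : A.transpose = A := by simpa [Matrix.IsHermitian] using hAH
    rw [Matrix.dotProduct_mulVec, ← Matrix.mulVec_transpose, hAt, hel, smul_dotProduct,
      smul_eq_mul]
  rw [← hyy, ← hyAy, ← hpars y y, ← hpars y (A.mulVec y), Finset.mul_sum]
  have hterm : ∀ k, c * (y ⬝ᵥ e k * (e k ⬝ᵥ y)) ≤ y ⬝ᵥ e k * (e k ⬝ᵥ A.mulVec y) := by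
    intro k
    rw [hsym, dotProduct_comm (e k)]
    rcases hle k with h | h
    · nlinarith [mul_self_nonneg (y ⬝ᵥ e k)]
    · simp [h]
  obtain ⟨k, hk⟩ := hy0
  refine Finset.sum_lt_sum (fun k _ => hterm k) ⟨k, Finset.mem_univ _, ?_⟩
  rw [hsym, dotProduct_comm (e k)]
  have h := (hle k).resolve_right hk
  nlinarith [mul_self_pos.2 hk]

/-! ### The gradient of the `α`-potential -/

/-- The vector `K_i - s_α r_i ^ α` of the coefficients of the `α`-form. -/
def curvDefect (T : AbstractSimplicialComplex V) (Φ : Finset V → ℝ) (α : ℝ) (u : V → ℝ) (i : V) :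
    ℝ :=
  gaussCurv T Φ (metricOf u) i - sAlpha T α (metricOf u) * metricOf u i ^ α

variable {T : AbstractSimplicialComplex V} {Φ : Finset V → ℝ} {α : ℝ}

lemma contDiff_curvDefect [Nonempty V] (hΦ : ∀ e ∈ edges T, Φ e ∈ Set.Icc 0 (Real.pi / 2))
    {n : WithTop ℕ∞} : ContDiff ℝ n (curvDefect T Φ α) := by
  refine contDiff_pi.2 fun i => (contDiff_gaussCurv hΦ i).sub ?_
  have hexp : ∀ j, ContDiff ℝ n fun u : V → ℝ => metricOf u j ^ α := by
    intro j
    simp only [metricOf_rpow]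
    exact (contDiff_const.mul (contDiff_apply ℝ ℝ j)).exp
  exact (contDiff_const.div (ContDiff.sum fun j _ => hexp j)
    fun u => (sum_metricOf_rpow_pos u).ne').mul (hexp i)

lemma sum_curvDefect [Nonempty V] (hT : IsClosedSurface T)
    (hΦ : ∀ e ∈ edges T, Φ e ∈ Set.Icc 0 (Real.pi / 2)) (u : V → ℝ) :
    ∑ i, curvDefect T Φ α u i = 0 := by
  have := (sum_metricOf_rpow_pos (α := α) u).ne'
  simp only [curvDefect]
  rw [Finset.sum_sub_distrib, sum_gaussCurv hT hΦ (metricOf_pos u), ← Finset.mul_sum, sAlpha]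
  field_simp
  ring

/-- The bracket is `∑ r_i ^ α` times the covariance of `v` and `w` under the normalized weights `r_i
^ α`; it comes from the dependence of `s_α` on the metric. -/
lemma sum_mul_fderiv_curvDefect [Nonempty V]
    (hΦ : ∀ e ∈ edges T, Φ e ∈ Set.Icc 0 (Real.pi / 2)) (u v w : V → ℝ) :
    ∑ i, v i * fderiv ℝ (curvDefect T Φ α) u w i =
      dirichletForm T Φ (metricOf u) v w - α * sAlpha T α (metricOf u) *
        (∑ i, metricOf u i ^ α * (v i * w i) - (∑ j, metricOf u j ^ α)⁻¹ *
          ((∑ i, metricOf u i ^ α * v i) * ∑ i, metricOf u i ^ α * w i)) := by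
  have hcoord : ∀ i, fderiv ℝ (curvDefect T Φ α) u w i =
      fderiv ℝ (fun u : V → ℝ => gaussCurv T Φ (metricOf u) i) u w -
        (α * sAlpha T α (metricOf u) * metricOf u i ^ α) *
          (w i - (∑ j, metricOf u j ^ α)⁻¹ * ∑ j, metricOf u j ^ α * w j) := by
    intro i
    have h1 := hasFDerivAt_pi'.1
      ((contDiff_curvDefect (α := α) hΦ (n := 1)).differentiable one_ne_zero u).hasFDerivAt i
    have h2 := ((contDiff_gaussCurv hΦ i (n := 1)).differentiable one_ne_zero u).hasFDerivAt.sub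
      (hasFDerivAt_sAlpha_mul_rpow (T := T) (α := α) u i)
    have := congrArg (fun D : (V → ℝ) →L[ℝ] ℝ => D w) (h1.unique h2)
    simpa [Finset.mul_sum] using this
  simp only [hcoord, mul_sub, Finset.sum_sub_distrib, ← sum_mul_fderiv_gaussCurv hΦ]
  congr 2
  · rw [Finset.mul_sum]
    exact Finset.sum_congr rfl fun i _ => by ring
  · generalize ∑ i, metricOf u i ^ α * w i = W
    generalize (∑ j, metricOf u j ^ α)⁻¹ = S
    rw [Finset.sum_mul, Finset.mul_sum, Finset.mul_sum]
    exact Finset.sum_congr rfl fun i _ => by ring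

lemma sum_mul_fderiv_curvDefect_comm [Nonempty V]
    (hΦ : ∀ e ∈ edges T, Φ e ∈ Set.Icc 0 (Real.pi / 2)) (u v w : V → ℝ) :
    ∑ i, v i * fderiv ℝ (curvDefect T Φ α) u w i =
      ∑ i, w i * fderiv ℝ (curvDefect T Φ α) u v i := by
  rw [sum_mul_fderiv_curvDefect hΦ, sum_mul_fderiv_curvDefect hΦ, dirichletForm_comm]
  simp only [mul_comm (v _), mul_comm (∑ i, _ * v i)]

lemma curvJacobian_metricOf (u : V → ℝ) (i j : V) :
    curvJacobian T Φ (metricOf u) i j =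
      fderiv ℝ (fun u : V → ℝ => gaussCurv T Φ (metricOf u) i) u (Pi.single j 1) := by
  simp [curvJacobian, metricOf]

lemma sum_curvJacobian_mul (u v : V → ℝ) (i : V) :
    ∑ j, curvJacobian T Φ (metricOf u) i j * v j =
      fderiv ℝ (fun u : V → ℝ => gaussCurv T Φ (metricOf u) i) u v := by
  conv_rhs => rw [pi_eq_sum_univ' v, map_sum]
  refine Finset.sum_congr rfl fun j _ => ?_
  rw [curvJacobian_metricOf, map_smul, smul_eq_mul, mul_comm]

lemma curvJacobian_comm (hΦ : ∀ e ∈ edges T, Φ e ∈ Set.Icc 0 (Real.pi / 2)) (u : V → ℝ)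
    (i j : V) : curvJacobian T Φ (metricOf u) i j = curvJacobian T Φ (metricOf u) j i := by
  have h : ∀ i j, curvJacobian T Φ (metricOf u) i j =
      dirichletForm T Φ (metricOf u) (Pi.single i 1) (Pi.single j 1) := by
    intro i j
    rw [← sum_mul_fderiv_gaussCurv hΦ, curvJacobian_metricOf]
    simp [Pi.single_apply]
  rw [h, h, dirichletForm_comm]

/-- The Hessian of the `α`-potential is positive definite modulo constants if the first positive
eigenvalue of `-Δ_α` exceeds `α s_α`. -/
lemma sum_mul_fderiv_curvDefect_pos (hT : IsClosedSurface T)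
    (hΦ : ∀ e ∈ edges T, Φ e ∈ Set.Icc 0 (Real.pi / 2)) {u : V → ℝ}
    (hα : α * sAlpha T α (metricOf u) < firstPosEigenvalue (-alphaLaplacian T Φ α (metricOf u)))
    {v : V → ℝ} (hv : ¬∃ a, ∀ i, v i = a) :
    0 < ∑ i, v i * fderiv ℝ (curvDefect T Φ α) u v i := by
  have : Nonempty V := hT.connected.nonempty
  have hS := sum_metricOf_rpow_pos (α := α) u
  set m : V → ℝ := fun i => metricOf u i ^ α with hm
  have hm0 : ∀ i, 0 < m i := fun i => Real.rpow_pos_of_pos (metricOf_pos u i) α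
  set a := (∑ i, m i)⁻¹ * ∑ i, m i * v i with ha
  -- Removing the weighted mean makes the spectral gap applicable. It leaves the Dirichlet form
  -- unchanged and turns the weighted variance of `v` into `∑ m_i w_i²`.
  set w : V → ℝ := fun i => v i + -a with hw
  have hw0 : w ≠ 0 := fun h => hv ⟨a, fun i => by
    have := congrFun h i
    simp only [hw, Pi.zero_apply] at this
    linarith⟩
  have hmw : ∑ i, m i * w i = 0 := by
    simp only [hw, mul_add, Finset.sum_add_distrib, ← Finset.sum_mul, ha]
    field_simp
    ring
  have hlap : -alphaLaplacian T Φ α (metricOf u) =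
      Matrix.of fun i j => 1 / m i * curvJacobian T Φ (metricOf u) i j := by
    ext i j
    simp [alphaLaplacian, hm]
  have hquad : ∀ x : V → ℝ, ∑ i, x i * ∑ j, curvJacobian T Φ (metricOf u) i j * x j =
      dirichletForm T Φ (metricOf u) x x := fun x => by
    simp only [sum_curvJacobian_mul, sum_mul_fderiv_gaussCurv hΦ]
  rw [hlap] at hα
  have key := mul_sum_lt_of_lt_firstPosEigenvalue (curvJacobian_comm hΦ u) (fun x hx => by
    rw [hquad] at hx
    have h0 := le_antisymm hx (dirichletForm_self_nonneg hΦ (metricOf_pos u) x)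
    exact ⟨x (Classical.arbitrary V), fun i =>
      eq_of_dirichletForm_self_eq_zero hT hΦ (metricOf_pos u) h0 _ _⟩) hm0 hα hw0 hmw
  rw [hquad, dirichletForm_add_const, dirichletForm_comm, dirichletForm_add_const] at key
  have hvar : ∑ i, m i * w i ^ 2 =
      ∑ i, m i * (v i * v i) - (∑ i, m i)⁻¹ * ((∑ i, m i * v i) * ∑ i, m i * v i) := by
    have h1 : ∀ i, m i * w i ^ 2 = m i * (v i * v i) - a * (m i * v i) - a * (m i * w i) :=
      fun i => by simp only [hw]; ring
    simp only [h1, Finset.sum_sub_distrib, ← Finset.mul_sum, hmw, ha]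
    ring
  rw [sum_mul_fderiv_curvDefect hΦ, ← hvar]
  linarith

/-- Angles lie in `[0, π]`, and `s_α r_i ^ α` is `2πχ` times the fraction `r_i ^ α / ∑ r_j ^ α ≤ 1`.
-/
lemma exists_norm_curvDefect_le [Nonempty V] : ∃ B, ∀ u, ‖curvDefect T Φ α u‖ ≤ B := by
  refine ⟨2 * Real.pi + (triangles T).card * Real.pi + |2 * Real.pi * eulerChar T|, fun u => ?_⟩
  have := Real.pi_pos
  refine (pi_norm_le_iff_of_nonneg (by positivity)).2 fun i => ?_
  have hS := sum_metricOf_rpow_pos (α := α) u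
  have hm : ∀ i, 0 < metricOf u i ^ α := fun i => Real.rpow_pos_of_pos (metricOf_pos u i) α
  refine (abs_sub _ _).trans (add_le_add (abs_gaussCurv_le T Φ _ i) ?_)
  rw [sAlpha, abs_mul, abs_div, abs_of_pos hS, abs_of_pos (hm i), div_mul_eq_mul_div,
    div_le_iff₀ hS]
  gcongr
  exact Finset.single_le_sum (f := fun i => metricOf u i ^ α) (fun i _ => (hm i).le)
    (Finset.mem_univ i)

end AlphaFlow

end

noncomputable section

namespace AlphaFlow

/-! ### Global solutions of bounded `C¹` vector fields -/

section ODE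

variable {E : Type*} [NormedAddCommGroup E] [NormedSpace ℝ E] [ProperSpace E] {f : E → E}

lemma exists_lipschitzOnWith_closedBall (hf : ContDiff ℝ 1 f) (x : E) (R : ℝ) :
    ∃ K, LipschitzOnWith K f (Metric.closedBall x R) :=
  hf.contDiffOn.exists_lipschitzOnWith one_ne_zero (convex_closedBall x R)
    (isCompact_closedBall x R)

lemma eqOn_Icc_of_hasDerivAt (hf : ContDiff ℝ 1 f) {a : ℝ} (ha : 0 < a) {γ γ' : ℝ → E}
    (hc : ContinuousOn γ (Set.Icc (-a) a)) (hc' : ContinuousOn γ' (Set.Icc (-a) a))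
    (h : ∀ t ∈ Set.Ioo (-a) a, HasDerivAt γ (f (γ t)) t)
    (h' : ∀ t ∈ Set.Ioo (-a) a, HasDerivAt γ' (f (γ' t)) t) (h0 : γ 0 = γ' 0) :
    Set.EqOn γ γ' (Set.Icc (-a) a) := by
  obtain ⟨R, hR⟩ := ((isCompact_Icc.image_of_continuousOn hc).union
    (isCompact_Icc.image_of_continuousOn hc')).isBounded.subset_closedBall 0
  obtain ⟨K, hK⟩ := exists_lipschitzOnWith_closedBall hf 0 R
  exact ODE_solution_unique_of_mem_Icc (v := fun _ => f) (s := fun _ => Metric.closedBall 0 R)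
    (fun _ _ => hK) (t₀ := 0) ⟨by linarith, ha⟩ hc h
    (fun t ht => hR (Or.inl ⟨t, Set.Ioo_subset_Icc_self ht, rfl⟩)) hc' h'
    (fun t ht => hR (Or.inr ⟨t, Set.Ioo_subset_Icc_self ht, rfl⟩)) h0

/-- A solution of speed at most `B` stays within distance `B * a` during time `a`, so
Picard–Lindelöf on that ball covers the whole interval `[-a, a]`. -/
lemma exists_solution_Icc (hf : ContDiff ℝ 1 f) {B : ℝ} (hB : ∀ x, ‖f x‖ ≤ B) (x : E) {a : ℝ}
    (ha : 0 < a) : ∃ γ : ℝ → E, γ 0 = x ∧ ContinuousOn γ (Set.Icc (-a) a) ∧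
      ∀ t ∈ Set.Ioo (-a) a, HasDerivAt γ (f (γ t)) t := by
  have hB0 : 0 ≤ B := (norm_nonneg _).trans (hB x)
  obtain ⟨K, hK⟩ := exists_lipschitzOnWith_closedBall hf x (B * a)
  have hPL : IsPicardLindelof (fun _ => f) (tmin := -a) (tmax := a)
      ⟨0, by constructor <;> linarith⟩ x ⟨B * a, by positivity⟩ 0 ⟨B, hB0⟩ K :=
    IsPicardLindelof.of_time_independent (fun y _ => hB y) hK (by
      simp only [sub_zero, zero_sub, neg_neg, max_self, NNReal.coe_zero]
      exact le_rfl)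
  obtain ⟨γ, h0, hγ⟩ := hPL.exists_eq_forall_mem_Icc_hasDerivWithinAt₀
  exact ⟨γ, h0, fun t ht => (hγ t ht).continuousWithinAt, fun t ht =>
    (hγ t (Set.Ioo_subset_Icc_self ht)).hasDerivAt (Icc_mem_nhds ht.1 ht.2)⟩

theorem existsUnique_solution (hf : ContDiff ℝ 1 f) {B : ℝ} (hB : ∀ x, ‖f x‖ ≤ B) (x : E) :
    ∃! γ : ℝ → E, (∀ t, HasDerivAt γ (f (γ t)) t) ∧ γ 0 = x := by
  have hpos : ∀ n : ℕ, (0 : ℝ) < n + 1 := fun n => by positivity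
  choose β h0 hc hβ using fun n : ℕ => exists_solution_Icc hf hB x (hpos n)
  have hle : ∀ {m n : ℕ}, m ≤ n → Set.EqOn (β m) (β n) (Set.Icc (-((m : ℝ) + 1)) (m + 1)) := by
    intro m n hmn
    have hmn' : (m : ℝ) ≤ n := by exact_mod_cast hmn
    exact eqOn_Icc_of_hasDerivAt hf (hpos m) (hc m)
      ((hc n).mono (Set.Icc_subset_Icc (by linarith) (by linarith))) (hβ m)
      (fun t ht => hβ n t ⟨by linarith [ht.1], by linarith [ht.2]⟩) ((h0 m).trans (h0 n).symm)
  have hglue : ∀ (n : ℕ) (t : ℝ), |t| < n + 1 → β ⌈|t|⌉₊ t = β n t := by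
    intro n t ht
    rcases le_total ⌈|t|⌉₊ n with h | h
    · have := Nat.le_ceil |t|
      exact hle h (abs_le.1 (by linarith))
    · exact (hle h (abs_le.1 ht.le)).symm
  -- Because `β n` lives on `[-(n + 1), n + 1]`, each `t` is interior to the interval chosen for it,
  -- and near `t` the glued function is a single `β n`.
  refine ⟨fun t => β ⌈|t|⌉₊ t, ⟨fun t => ?_, by simp [h0]⟩, ?_⟩
  · have ht : |t| < (⌈|t|⌉₊ : ℝ) + 1 := by linarith [Nat.le_ceil |t|]
    refine (hβ ⌈|t|⌉₊ t (abs_lt.1 ht)).congr_of_eventuallyEq ?_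
    filter_upwards [(continuous_abs.tendsto t).eventually (gt_mem_nhds ht)] with s hs
    exact hglue _ s hs
  · rintro γ ⟨hγ, hγ0⟩
    funext t
    have ht : |t| ≤ (⌈|t|⌉₊ : ℝ) + 1 := by linarith [Nat.le_ceil |t|]
    exact eqOn_Icc_of_hasDerivAt hf (hpos _)
      (fun s _ => (hγ s).continuousAt.continuousWithinAt) (hc ⌈|t|⌉₊) (fun s _ => hγ s)
      (hβ _) (hγ0.trans (h0 _).symm) (abs_le.1 ht)

/-- If a function and its derivative both converge at infinity, then the derivative tends to `0`. -/
lemma eq_zero_of_tendsto_of_hasDerivAt {g g' : ℝ → ℝ} {a c : ℝ}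
    (hg : ∀ t, HasDerivAt g (g' t) t) (ha : Tendsto g atTop (𝓝 a))
    (hc : Tendsto g' atTop (𝓝 c)) : c = 0 := by
  choose ξ hξ hs using fun t : ℝ => exists_hasDerivAt_eq_slope g g' (lt_add_one t)
    (fun s _ => (hg s).continuousAt.continuousWithinAt) (fun s _ => hg s)
  have hξ' : Tendsto ξ atTop atTop := tendsto_atTop_mono (fun t => (hξ t).1.le) tendsto_id
  have h1 : Tendsto (fun t => g (t + 1) - g t) atTop (𝓝 (a - a)) :=
    (ha.comp (tendsto_atTop_add_const_right atTop 1 tendsto_id)).sub ha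
  have h2 := hc.comp hξ'
  have h3 : g' ∘ ξ = fun t => g (t + 1) - g t := funext fun t => by
    simp [hs]
  rw [h3] at h2
  simpa using tendsto_nhds_unique h2 h1

end ODE

variable {V : Type*} [Fintype V]

/-! ### Gradient fields that are strictly monotone modulo constants -/

/-- A `C¹` vector field on `ℝ^V` with symmetric Jacobian, tangent to the hyperplanes of constant
coordinate sum, whose Jacobian is positive definite modulo constants. -/
structure IsMonotoneField (G : (V → ℝ) → V → ℝ) : Prop where
  contDiff : ContDiff ℝ 1 G
  sum_eq_zero : ∀ u, ∑ i, G u i = 0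
  symm : ∀ u v w, ∑ i, v i * fderiv ℝ G u w i = ∑ i, w i * fderiv ℝ G u v i
  pos : ∀ u v, (¬∃ a, ∀ i, v i = a) → 0 < ∑ i, v i * fderiv ℝ G u v i

lemma not_const_of_sum_eq_zero {v : V → ℝ} (h : ∑ i, v i = 0) (hv : v ≠ 0) :
    ¬∃ a, ∀ i, v i = a := by
  rintro ⟨a, ha⟩
  refine hv (funext fun i => ?_)
  have : Nonempty V := ⟨i⟩
  simp only [ha, Finset.sum_const, Finset.card_univ, nsmul_eq_mul, mul_eq_zero,
    Nat.cast_eq_zero, Fintype.card_ne_zero, false_or] at h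
  simp [ha, h]

lemma hasDerivAt_potential_line {F : (V → ℝ) → ℝ} {G : (V → ℝ) → V → ℝ}
    (hF : ∀ u, HasFDerivAt F (∑ i, G u i • ContinuousLinearMap.proj (R := ℝ)
      (φ := fun _ : V => ℝ) i) u) (x v : V → ℝ) (t : ℝ) :
    HasDerivAt (fun s : ℝ => F (x + s • v)) (∑ i, v i * G (x + t • v) i) t := by
  have hl : HasDerivAt (fun s : ℝ => x + s • v) v t := by
    simpa using ((hasDerivAt_id t).smul_const v).const_add x
  refine ((hF (x + t • v)).comp_hasDerivAt t hl).congr_deriv ?_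
  simp [mul_comm]

namespace IsMonotoneField

variable {G : (V → ℝ) → V → ℝ} (hG : IsMonotoneField G)
include hG

lemma hasFDerivAt (u : V → ℝ) : HasFDerivAt G (fderiv ℝ G u) u :=
  (hG.contDiff.differentiable one_ne_zero u).hasFDerivAt

lemma hasDerivAt_line (x v w : V → ℝ) (t : ℝ) :
    HasDerivAt (fun s : ℝ => ∑ i, w i * G (x + s • v) i)
      (∑ i, w i * fderiv ℝ G (x + t • v) v i) t := by
  have hl : HasDerivAt (fun s : ℝ => x + s • v) v t := by
    simpa using ((hasDerivAt_id t).smul_const v).const_add x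
  have h := (hG.hasFDerivAt (x + t • v)).comp_hasDerivAt t hl
  exact HasDerivAt.fun_sum fun i _ => (hasDerivAt_pi.1 h i).const_mul (w i)

/-- Constant coordinate sum puts the constants in the left kernel of the Jacobian; symmetry puts
them in the right kernel. -/
lemma fderiv_const (u : V → ℝ) : fderiv ℝ G u (fun _ => 1) = 0 := by
  classical
  funext i
  have h1 := hG.symm u (Pi.single i 1) fun _ => 1
  have h2 := hG.hasDerivAt_line u (Pi.single i 1) (fun _ => 1) 0
  simp only [one_mul, hG.sum_eq_zero, zero_smul, add_zero] at h2
  have h3 := h2.unique (hasDerivAt_const (0 : ℝ) (0 : ℝ))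
  simpa [Pi.single_apply, h3] using h1

lemma add_const (u : V → ℝ) (c : ℝ) : G (u + c • fun _ => 1) = G u := by
  classical
  funext i
  have h : ∀ t, HasDerivAt (fun s : ℝ => ∑ j, (Pi.single i 1 : V → ℝ) j *
      G (u + s • fun _ => 1) j) 0 t := by
    intro t
    simpa [hG.fderiv_const] using hG.hasDerivAt_line u (fun _ => 1) (Pi.single i 1) t
  have := is_const_of_deriv_eq_zero (fun t => (h t).differentiableAt) (fun t => (h t).deriv) c 0
  simpa [Pi.single_apply] using this

lemma strictMono_line {x v : V → ℝ} (hv : ¬∃ a, ∀ i, v i = a) :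
    StrictMono fun s : ℝ => ∑ i, v i * G (x + s • v) i :=
  strictMono_of_hasDerivAt_pos (fun t => hG.hasDerivAt_line x v v t) fun _ => hG.pos _ v hv

/-- On the compact product of the ball with the unit vectors of sum zero, the Hessian form has a
positive minimum. The mean value theorem along the segment from `x` to `x + w` transfers it to `G`.
-/
lemma exists_pos_mul_norm_sq_le (x : V → ℝ) (hx : G x = 0) (R : ℝ) :
    ∃ δ > 0, ∀ w : V → ℝ, ∑ i, w i = 0 → ‖w‖ ≤ R → δ * ‖w‖ ^ 2 ≤ ∑ i, w i * G (x + w) i := by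
  set q : (V → ℝ) × (V → ℝ) → ℝ := fun p => ∑ i, p.2 i * fderiv ℝ G p.1 p.2 i with hq
  have hqc : Continuous q := by
    have h1 : Continuous fun p : (V → ℝ) × (V → ℝ) => fderiv ℝ G p.1 p.2 :=
      ((hG.contDiff.continuous_fderiv one_ne_zero).comp continuous_fst).clm_apply continuous_snd
    exact continuous_finsetSum _ fun i _ => ((continuous_apply i).comp continuous_snd).mul
      ((continuous_apply i).comp h1)
  set S : Set (V → ℝ) := Metric.sphere 0 1 ∩ {v | ∑ i, v i = 0} with hS
  have hSc : IsCompact S := (isCompact_sphere 0 1).inter_right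
    (isClosed_eq (continuous_finsetSum _ fun i _ => continuous_apply i) continuous_const)
  have hKc : IsCompact (Metric.closedBall x R ×ˢ S) := (isCompact_closedBall x R).prod hSc
  obtain ⟨δ, hδ, hmin⟩ : ∃ δ > 0, ∀ p ∈ Metric.closedBall x R ×ˢ S, δ ≤ q p := by
    -- The product is empty if `R < 0` or if there is at most one vertex; any constant then serves.
    rcases (Metric.closedBall x R ×ˢ S).eq_empty_or_nonempty with h | h
    · exact ⟨1, one_pos, by simp [h]⟩
    · obtain ⟨p, hp, hpm⟩ := hKc.exists_isMinOn h hqc.continuousOn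
      refine ⟨q p, hG.pos _ _ (not_const_of_sum_eq_zero hp.2.2 ?_), fun p' hp' => hpm hp'⟩
      exact norm_ne_zero_iff.1 (by rw [mem_sphere_zero_iff_norm.1 hp.2.1]; exact one_ne_zero)
  refine ⟨δ, hδ, fun w hw hwR => ?_⟩
  have hquad : ∀ y ∈ Metric.closedBall x R, δ * ‖w‖ ^ 2 ≤ ∑ i, w i * fderiv ℝ G y w i := by
    intro y hy
    rcases eq_or_ne w 0 with rfl | hw0
    · simp
    have hn := norm_pos_iff.2 hw0
    have hmem : (y, ‖w‖⁻¹ • w) ∈ Metric.closedBall x R ×ˢ S :=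
      ⟨hy, by simp [norm_smul, hn.ne'], by simp [← Finset.mul_sum, hw]⟩
    have h1 := hmin _ hmem
    have h2 : q (y, ‖w‖⁻¹ • w) = (‖w‖⁻¹) ^ 2 * ∑ i, w i * fderiv ℝ G y w i := by
      simp only [hq, map_smul, Pi.smul_apply, smul_eq_mul, Finset.mul_sum]
      exact Finset.sum_congr rfl fun i _ => by ring
    rw [h2, inv_pow, inv_mul_eq_div, le_div_iff₀ (by positivity)] at h1
    exact h1
  obtain ⟨ξ, hξ, hs⟩ := exists_hasDerivAt_eq_slope (fun s : ℝ => ∑ i, w i * G (x + s • w) i) _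
    zero_lt_one (fun s _ => (hG.hasDerivAt_line x w w s).continuousAt.continuousWithinAt)
    (fun s _ => hG.hasDerivAt_line x w w s)
  have hb : x + ξ • w ∈ Metric.closedBall x R := by
    rw [mem_closedBall_iff_norm, add_sub_cancel_left, norm_smul, Real.norm_of_nonneg hξ.1.le]
    nlinarith [hξ.2, norm_nonneg w]
  have h1 := hquad _ hb
  rw [hs] at h1
  simpa [hx] using h1

lemma monotone_of_eq_zero {x : V → ℝ} (hx : G x = 0) {w : V → ℝ} (hw : ∑ i, w i = 0) :
    0 ≤ ∑ i, w i * G (x + w) i := by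
  obtain ⟨δ, hδ, h⟩ := hG.exists_pos_mul_norm_sq_le x hx ‖w‖
  exact le_trans (by positivity) (h w hw le_rfl)

lemma exists_zero_of_sum_eq {x : V → ℝ} (hx : G x = 0) [Nonempty V] (c : ℝ) :
    ∃ y, G y = 0 ∧ ∑ i, y i = c := by
  refine ⟨x + ((c - ∑ i, x i) / Fintype.card V) • fun _ => 1, by rw [hG.add_const, hx], ?_⟩
  simp only [Pi.add_apply, Pi.smul_apply, smul_eq_mul, mul_one, Finset.sum_add_distrib,
    Finset.sum_const, Finset.card_univ, nsmul_eq_mul]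
  field_simp
  ring

/-- Trajectories of the descending gradient flow with the coordinate sum of a zero `x` of the
field converge to `x` exponentially fast. -/
theorem exists_exp_bound [Nonempty V] {x : V → ℝ} (hx : G x = 0) {u : ℝ → V → ℝ}
    (hu : ∀ t i, HasDerivAt (fun s => u s i) (-G (u t) i) t) (hsum : ∑ i, x i = ∑ i, u 0 i) :
    ∃ C δ : ℝ, 0 < δ ∧ ∀ t, 0 ≤ t → ‖u t - x‖ ≤ C * Real.exp (-δ * t) := by
  have hcons : ∀ t, ∑ i, (u t - x) i = 0 := by
    intro t
    have hd : ∀ t, HasDerivAt (fun s => ∑ i, u s i) 0 t := by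
      intro t
      have := HasDerivAt.fun_sum (u := Finset.univ) fun i _ => hu t i
      rwa [Finset.sum_neg_distrib, hG.sum_eq_zero, neg_zero] at this
    have h := is_const_of_deriv_eq_zero (fun t => (hd t).differentiableAt)
      (fun t => (hd t).deriv) t 0
    simp only [Pi.sub_apply, Finset.sum_sub_distrib, hsum]
    linarith
  -- The Lyapunov function is the Euclidean squared distance, although the ambient norm is the sup
  -- norm; the comparison costs a factor `Fintype.card V`.
  set d : ℝ → ℝ := fun t => ∑ i, (u t i - x i) ^ 2
  set g : ℝ → ℝ := fun t => ∑ i, (u t - x) i * G (u t) i with hg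
  have hderiv : ∀ t, HasDerivAt d (-2 * g t) t := by
    intro t
    have := HasDerivAt.fun_sum (u := Finset.univ) fun i _ => ((hu t i).sub_const (x i)).pow 2
    refine this.congr_deriv ?_
    rw [hg, Finset.mul_sum]
    exact Finset.sum_congr rfl fun i _ => by simp; ring
  have hg0 : ∀ t, 0 ≤ g t := fun t => by
    simpa [hg] using hG.monotone_of_eq_zero hx (hcons t)
  have hanti : Antitone d := antitone_of_hasDerivAt_nonpos hderiv fun t => by
    have := hg0 t
    simp only [Pi.zero_apply]
    linarith
  have hnorm : ∀ t, ‖u t - x‖ ^ 2 ≤ d t := by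
    intro t
    have hd0 : 0 ≤ d t := Finset.sum_nonneg fun i _ => sq_nonneg _
    refine (Real.le_sqrt (norm_nonneg _) hd0).1
      ((pi_norm_le_iff_of_nonneg (Real.sqrt_nonneg _)).2 fun i => ?_)
    refine Real.abs_le_sqrt ?_
    exact Finset.single_le_sum (f := fun i => (u t i - x i) ^ 2) (fun i _ => sq_nonneg _)
      (Finset.mem_univ i)
  -- Monotonicity of `d` already confines the trajectory to the ball of radius `√(d 0)` about `x`,
  -- so one constant works for all `t ≥ 0`.
  obtain ⟨δ, hδ, hmono⟩ := hG.exists_pos_mul_norm_sq_le x hx √(d 0)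
  have hcard : ∀ t, d t ≤ Fintype.card V * ‖u t - x‖ ^ 2 := by
    intro t
    calc d t ≤ ∑ _i : V, ‖u t - x‖ ^ 2 := Finset.sum_le_sum fun i _ => by
          rw [← sq_abs (u t i - x i)]
          exact pow_le_pow_left₀ (abs_nonneg _) (norm_le_pi_norm (u t - x) i) 2
      _ = _ := by simp
  have hN : (0 : ℝ) < Fintype.card V := by exact_mod_cast Fintype.card_pos
  set κ : ℝ := 2 * δ / Fintype.card V with hκ
  have hκ0 : 0 < κ := by positivity
  have hdiff : ∀ t, 0 ≤ t → κ * d t ≤ 2 * g t := by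
    intro t ht
    have h1 := hmono (u t - x) (hcons t) (Real.le_sqrt_of_sq_le ((hnorm t).trans (hanti ht)))
    rw [add_sub_cancel] at h1
    calc κ * d t ≤ κ * (Fintype.card V * ‖u t - x‖ ^ 2) := by gcongr; exact hcard t
      _ = 2 * (δ * ‖u t - x‖ ^ 2) := by rw [hκ]; field_simp
      _ ≤ 2 * g t := by gcongr
  have hexp : AntitoneOn (fun t => Real.exp (κ * t) * d t) (Set.Ici 0) := by
    have hder : ∀ t, HasDerivAt (fun t => Real.exp (κ * t) * d t)
        (Real.exp (κ * t) * (κ * d t - 2 * g t)) t := by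
      intro t
      refine ((((hasDerivAt_id t).const_mul κ).exp).mul (hderiv t)).congr_deriv ?_
      simp; ring
    refine antitoneOn_of_hasDerivWithinAt_nonpos (convex_Ici 0)
      (fun t _ => (hder t).continuousAt.continuousWithinAt)
      (fun t _ => (hder t).hasDerivWithinAt) fun t ht => ?_
    rw [interior_Ici] at ht
    exact mul_nonpos_of_nonneg_of_nonpos (Real.exp_pos _).le
      (by linarith [hdiff t (le_of_lt ht)])
  -- Half the rate `κ` of `d`, since `d` is a squared distance.
  refine ⟨√(d 0), κ / 2, by positivity, fun t ht => ?_⟩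
  have h1 : Real.exp (κ * t) * d t ≤ d 0 := by
    simpa using hexp (Set.mem_Ici.2 le_rfl) (Set.mem_Ici.2 ht) ht
  refine abs_le_of_sq_le_sq' (a := ‖u t - x‖) ?_ (by positivity) |>.2
  have hd0 : 0 ≤ d 0 := Finset.sum_nonneg fun i _ => sq_nonneg _
  rw [mul_pow, Real.sq_sqrt hd0, ← Real.exp_nat_mul]
  have h2 : ((2 : ℕ) : ℝ) * (-(κ / 2) * t) = -(κ * t) := by push_cast; ring
  rw [h2, Real.exp_neg, ← div_eq_mul_inv, le_div_iff₀ (Real.exp_pos _), mul_comm]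
  exact (mul_le_mul_of_nonneg_left (hnorm t) (Real.exp_pos _).le).trans h1

/-! ### Convexity and growth of the potential -/

variable {F : (V → ℝ) → ℝ}

/-- Along a line in a nonconstant direction, the derivative of the potential is strictly increasing.
-/
lemma strictConvexOn_potential
    (hF : ∀ u, HasFDerivAt F (∑ i, G u i • ContinuousLinearMap.proj (R := ℝ)
      (φ := fun _ : V => ℝ) i) u) : StrictConvexOn ℝ (sumZero V) F := by
  refine ⟨?_, fun x hx y hy hxy a b ha hb hab => ?_⟩
  · intro x hx y hy a b _ _ _
    simp only [sumZero, Set.mem_ofPred_eq] at hx hy ⊢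
    simp [Finset.sum_add_distrib, ← Finset.mul_sum, hx, hy]
  · have hv : ¬∃ c, ∀ i, (y - x) i = c := by
      refine not_const_of_sum_eq_zero ?_ (sub_ne_zero.2 hxy.symm)
      simp only [sumZero, Set.mem_ofPred_eq] at hx hy
      simp [hx, hy]
    have hd := hasDerivAt_potential_line hF x (y - x)
    have hcv : StrictConvexOn ℝ Set.univ fun s : ℝ => F (x + s • (y - x)) := by
      refine StrictMono.strictConvexOn_univ_of_deriv
        (continuous_iff_continuousAt.2 fun t => (hd t).continuousAt) ?_
      rw [funext fun t => (hd t).deriv]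
      exact hG.strictMono_line hv
    have := hcv.2 (Set.mem_univ 0) (Set.mem_univ 1) zero_ne_one ha hb hab
    simp only [smul_eq_mul, mul_zero, mul_one, zero_add, zero_smul, add_zero, one_smul,
      add_sub_cancel] at this
    have he : x + b • (y - x) = a • x + b • y := by
      rw [eq_sub_of_add_eq hab, sub_smul, smul_sub, one_smul]; abel
    rwa [he] at this

/-- Along each ray from the minimum `x` the slope is at least `δ` at distance `1`, and it increases
afterwards. Inside the unit ball the bound only says that `x` is a minimum. -/
lemma exists_linear_growth
    (hF : ∀ u, HasFDerivAt F (∑ i, G u i • ContinuousLinearMap.proj (R := ℝ)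
      (φ := fun _ : V => ℝ) i) u) {x : V → ℝ} (hx : G x = 0) :
    ∃ δ > 0, ∀ w : V → ℝ, ∑ i, w i = 0 → F x + δ * (‖w‖ - 1) ≤ F (x + w) := by
  obtain ⟨δ, hδ, hmono⟩ := hG.exists_pos_mul_norm_sq_le x hx 1
  refine ⟨δ, hδ, fun w hw => ?_⟩
  have hslope : ∀ (v : V → ℝ) {a b : ℝ}, a < b → ∃ ξ ∈ Set.Ioo a b,
      ∑ i, v i * G (x + ξ • v) i = (F (x + b • v) - F (x + a • v)) / (b - a) := fun v a b hab =>
    exists_hasDerivAt_eq_slope (fun s : ℝ => F (x + s • v)) _ hab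
      (fun s _ => (hasDerivAt_potential_line hF x v s).continuousAt.continuousWithinAt)
      (fun s _ => hasDerivAt_potential_line hF x v s)
  have hbase : ∀ v : V → ℝ, ∑ i, v i = 0 → F x ≤ F (x + v) := by
    intro v hv
    obtain ⟨ξ, hξ, hs⟩ := hslope v zero_lt_one
    have h1 := hG.monotone_of_eq_zero hx (w := ξ • v) (by simp [← Finset.mul_sum, hv])
    simp only [Pi.smul_apply, smul_eq_mul, mul_assoc, ← Finset.mul_sum, hs] at h1
    have := nonneg_of_mul_nonneg_right h1 hξ.1
    simpa using this
  rcases le_or_gt ‖w‖ 1 with h | h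
  · nlinarith [hbase w hw]
  have hn : 0 < ‖w‖ := by linarith
  set v : V → ℝ := ‖w‖⁻¹ • w with hv
  have hvn : ‖v‖ = 1 := by simp [hv, norm_smul, hn.ne']
  have hv0 : ∑ i, v i = 0 := by simp [hv, ← Finset.mul_sum, hw]
  have hwv : w = ‖w‖ • v := by simp [hv, smul_smul, hn.ne']
  obtain ⟨ξ, hξ, hs⟩ := hslope v h
  have h1 := hmono v hv0 hvn.le
  have hvne : v ≠ 0 := by rw [← norm_ne_zero_iff, hvn]; exact one_ne_zero
  have h2 := (hG.strictMono_line (x := x) (not_const_of_sum_eq_zero hv0 hvne)).monotone hξ.1.le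
  simp only [one_smul] at h2
  rw [hs, one_smul, le_div_iff₀ (by linarith)] at h2
  rw [hvn] at h1
  have h3 := hbase v hv0
  have h4 : δ * (‖w‖ - 1) ≤ (∑ i, v i * G (x + v) i) * (‖w‖ - 1) := by
    have : 0 ≤ ‖w‖ - 1 := by linarith
    gcongr
    linarith
  rw [← hwv] at h2
  linarith

lemma tendsto_potential_atTop [Nonempty V]
    (hF : ∀ u, HasFDerivAt F (∑ i, G u i • ContinuousLinearMap.proj (R := ℝ)
      (φ := fun _ : V => ℝ) i) u) {x : V → ℝ} (hx : G x = 0) :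
    Tendsto ((sumZero V).domRestrict F) (cocompact (sumZero V)) atTop := by
  obtain ⟨y, hy, hysum⟩ := hG.exists_zero_of_sum_eq hx 0
  obtain ⟨δ, hδ, hgrow⟩ := hG.exists_linear_growth hF hy
  have hclosed : IsClosed (sumZero V) :=
    isClosed_eq (continuous_finsetSum _ fun i _ => continuous_apply i) continuous_const
  have h1 : Tendsto (fun u : sumZero V => ‖(u : V → ℝ)‖) (cocompact (sumZero V)) atTop :=
    tendsto_norm_cocompact_atTop.comp hclosed.isClosedEmbedding_subtypeVal.tendsto_cocompact
  have h2 : Tendsto (fun u : sumZero V => F y + δ * (‖(u : V → ℝ)‖ + (-‖y‖ - 1)))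
      (cocompact (sumZero V)) atTop :=
    tendsto_atTop_add_const_left _ _
      ((tendsto_atTop_add_const_right _ _ h1).const_mul_atTop hδ)
  refine tendsto_atTop_mono (fun u => ?_) h2
  have h3 := hgrow (u - y) (by
    have := u.2
    simp only [sumZero, Set.mem_ofPred_eq] at this
    simp [hysum, this])
  rw [add_sub_cancel] at h3
  have h4 := norm_sub_norm_le (u : V → ℝ) y
  refine le_trans ?_ h3
  gcongr
  linarith

lemma isProperMap_potential [Nonempty V]
    (hF : ∀ u, HasFDerivAt F (∑ i, G u i • ContinuousLinearMap.proj (R := ℝ)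
      (φ := fun _ : V => ℝ) i) u) {x : V → ℝ} (hx : G x = 0) :
    IsProperMap ((sumZero V).domRestrict F) := by
  refine isProperMap_iff_tendsto_cocompact.2 ⟨?_, ?_⟩
  · exact (continuous_iff_continuousAt.2 fun u => (hF u).continuousAt).comp continuous_subtype_val
  · exact (hG.tendsto_potential_atTop hF hx).mono_right atTop_le_cocompact

/-- The Poincaré lemma on a convex set: symmetry of the Jacobian says that the form is closed. -/
lemma hasFDerivAt_curveIntegral_segment (a u : V → ℝ) :
    HasFDerivAt (fun y => curveIntegral (fun u => ∑ i, G u i •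
        ContinuousLinearMap.proj (R := ℝ) (φ := fun _ : V => ℝ) i) (Path.segment a y))
      (∑ i, G u i • ContinuousLinearMap.proj (R := ℝ) (φ := fun _ : V => ℝ) i) u := by
  have hω : ∀ y, HasFDerivAt (fun u => ∑ i, G u i •
      ContinuousLinearMap.proj (R := ℝ) (φ := fun _ : V => ℝ) i)
      (∑ i, ((ContinuousLinearMap.proj (R := ℝ) (φ := fun _ : V => ℝ) i).comp
        (fderiv ℝ G y)).smulRight (ContinuousLinearMap.proj (R := ℝ) (φ := fun _ : V => ℝ) i)) y :=
    fun y => HasFDerivAt.fun_sum fun i _ => by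
      exact (hasFDerivAt_pi'.1 (hG.hasFDerivAt y) i).smul_const
        (ContinuousLinearMap.proj (R := ℝ) (φ := fun _ : V => ℝ) i)
  have := convex_univ.hasFDerivWithinAt_curveIntegral_segment_of_hasFDerivWithinAt_symmetric
    (fun y _ => (hω y).hasFDerivWithinAt) (fun y _ v _ w _ => ?_) (Set.mem_univ a)
    (Set.mem_univ u)
  · exact hasFDerivWithinAt_univ.1 this
  · simpa [mul_comm] using hG.symm y w v

end IsMonotoneField

end AlphaFlow

end

noncomputable section

namespace AlphaFlow

variable {V : Type*} [Fintype V] [DecidableEq V]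

/-! ### The `α`-flow -/

variable {T : AbstractSimplicialComplex V} {Φ : Finset V → ℝ} {α : ℝ}

lemma isMonotoneField_curvDefect (hT : IsClosedSurface T)
    (hΦ : ∀ e ∈ edges T, Φ e ∈ Set.Icc 0 (Real.pi / 2))
    (hα : ∀ r : V → ℝ, (∀ i, 0 < r i) →
      α * sAlpha T α r < firstPosEigenvalue (-alphaLaplacian T Φ α r)) :
    IsMonotoneField (curvDefect T Φ α) :=
  have : Nonempty V := hT.connected.nonempty
  { contDiff := contDiff_curvDefect hΦ
    sum_eq_zero := sum_curvDefect hT hΦ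
    symm := sum_mul_fderiv_curvDefect_comm hΦ
    pos := fun u _ hv => sum_mul_fderiv_curvDefect_pos hT hΦ (hα _ (metricOf_pos u)) hv }

lemma isAlphaFlow_iff {u : ℝ → V → ℝ} :
    IsAlphaFlow T Φ α u ↔ ∀ t i, HasDerivAt (fun s => u s i) (-curvDefect T Φ α (u t) i) t := by
  simp only [IsAlphaFlow, curvDefect, neg_sub]

/-- Summing `K_i = c r_i ^ α` and applying Gauss–Bonnet gives `c = s_α`. -/
lemma isConstAlphaCurvMetric_metricOf_iff (hT : IsClosedSurface T)
    (hΦ : ∀ e ∈ edges T, Φ e ∈ Set.Icc 0 (Real.pi / 2)) (u : V → ℝ) :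
    IsConstAlphaCurvMetric T Φ α (metricOf u) ↔ curvDefect T Φ α u = 0 := by
  have : Nonempty V := hT.connected.nonempty
  have hm : ∀ i, 0 < metricOf u i ^ α := fun i => Real.rpow_pos_of_pos (metricOf_pos u i) α
  constructor
  · rintro ⟨-, c, hc⟩
    have hK : ∀ i, gaussCurv T Φ (metricOf u) i = c * metricOf u i ^ α := fun i => by
      rw [← hc i, alphaCurv, div_mul_cancel₀ _ (hm i).ne']
    have hs : sAlpha T α (metricOf u) = c := by
      rw [sAlpha, ← sum_gaussCurv hT hΦ (metricOf_pos u), div_eq_iff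
        (sum_metricOf_rpow_pos u).ne', Finset.mul_sum]
      exact Finset.sum_congr rfl fun i _ => hK i
    funext i
    simp [curvDefect, hs, hK i]
  · intro h
    refine ⟨metricOf_pos u, sAlpha T α (metricOf u), fun i => ?_⟩
    rw [alphaCurv, div_eq_iff (hm i).ne']
    exact sub_eq_zero.1 (congrFun h i)

lemma exists_isConstAlphaCurvMetric_iff (hT : IsClosedSurface T)
    (hΦ : ∀ e ∈ edges T, Φ e ∈ Set.Icc 0 (Real.pi / 2)) :
    (∃ r, IsConstAlphaCurvMetric T Φ α r) ↔ ∃ u, curvDefect T Φ α u = 0 := by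
  constructor
  · rintro ⟨r, hr⟩
    have : metricOf (fun i => Real.log (r i)) = r := funext fun i => Real.exp_log (hr.1 i)
    exact ⟨_, (isConstAlphaCurvMetric_metricOf_iff hT hΦ _).1 (this.symm ▸ hr)⟩
  · rintro ⟨u, hu⟩
    exact ⟨_, (isConstAlphaCurvMetric_metricOf_iff hT hΦ u).2 hu⟩

theorem existsUnique_alphaFlow (hT : IsClosedSurface T)
    (hΦ : ∀ e ∈ edges T, Φ e ∈ Set.Icc 0 (Real.pi / 2)) (u₀ : V → ℝ) :
    ∃! u : ℝ → V → ℝ, IsAlphaFlow T Φ α u ∧ u 0 = u₀ := by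
  have : Nonempty V := hT.connected.nonempty
  obtain ⟨B, hB⟩ := exists_norm_curvDefect_le (T := T) (Φ := Φ) (α := α)
  have h := existsUnique_solution (f := fun u => -curvDefect T Φ α u)
    (contDiff_curvDefect hΦ).neg (B := B) (fun u => by rw [norm_neg]; exact hB u) u₀
  simpa only [isAlphaFlow_iff, hasDerivAt_pi, Pi.neg_apply] using h

theorem curvDefect_eq_zero_of_tendsto (hT : IsClosedSurface T)
    (hΦ : ∀ e ∈ edges T, Φ e ∈ Set.Icc 0 (Real.pi / 2)) {u : ℝ → V → ℝ}
    (hu : IsAlphaFlow T Φ α u) {u' : V → ℝ} (h : Tendsto u atTop (𝓝 u')) :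
    curvDefect T Φ α u' = 0 := by
  have : Nonempty V := hT.connected.nonempty
  have hc := ((contDiff_curvDefect (T := T) (α := α) hΦ (n := 0)).continuous.tendsto u').comp h
  funext i
  have := eq_zero_of_tendsto_of_hasDerivAt (fun t => isAlphaFlow_iff.1 hu t i)
    (tendsto_pi_nhds.1 h i) (tendsto_pi_nhds.1 hc i).neg
  simpa using this

/-- The limit is the zero of `curvDefect` with the coordinate sum of `u 0`, which the flow
conserves. -/
theorem exists_exp_convergence (hT : IsClosedSurface T)
    (hΦ : ∀ e ∈ edges T, Φ e ∈ Set.Icc 0 (Real.pi / 2))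
    (hα : ∀ r : V → ℝ, (∀ i, 0 < r i) →
      α * sAlpha T α r < firstPosEigenvalue (-alphaLaplacian T Φ α r))
    (hr : ∃ r, IsConstAlphaCurvMetric T Φ α r) {u : ℝ → V → ℝ} (hu : IsAlphaFlow T Φ α u) :
    ∃ u', IsConstAlphaCurvMetric T Φ α (metricOf u') ∧
      ∃ C δ : ℝ, 0 < δ ∧ ∀ t : ℝ, 0 ≤ t → ‖u t - u'‖ ≤ C * Real.exp (-δ * t) := by
  have : Nonempty V := hT.connected.nonempty
  have hG := isMonotoneField_curvDefect hT hΦ hα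
  obtain ⟨x, hx⟩ := (exists_isConstAlphaCurvMetric_iff hT hΦ).1 hr
  obtain ⟨y, hy, hsum⟩ := hG.exists_zero_of_sum_eq hx (∑ i, u 0 i)
  exact ⟨y, (isConstAlphaCurvMetric_metricOf_iff hT hΦ y).2 hy,
    hG.exists_exp_bound hy (isAlphaFlow_iff.1 hu) hsum⟩

lemma tendsto_of_exp_bound {E : Type*} [SeminormedAddCommGroup E] {u : ℝ → E} {x : E} {C δ : ℝ}
    (hδ : 0 < δ) (h : ∀ t, 0 ≤ t → ‖u t - x‖ ≤ C * Real.exp (-δ * t)) :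
    Tendsto u atTop (𝓝 x) := by
  refine tendsto_iff_norm_sub_tendsto_zero.2 (squeeze_zero' (g := fun t => C * Real.exp (-δ * t))
    (Eventually.of_forall fun t => norm_nonneg _)
    ((eventually_ge_atTop 0).mono fun t ht => h t ht) ?_)
  have h1 : Tendsto (fun t : ℝ => -δ * t) atTop atBot :=
    tendsto_id.const_mul_atTop_of_neg (neg_lt_zero.2 hδ)
  simpa using (Real.tendsto_exp_atBot.comp h1).const_mul C

end AlphaFlow

end

theorem mainTheorem2 {V : Type*} [Fintype V] [DecidableEq V]
    (T : AbstractSimplicialComplex V) (hT : AlphaFlow.IsClosedSurface T)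
    (Φ : Finset V → ℝ) (hΦ : ∀ e ∈ AlphaFlow.edges T, Φ e ∈ Set.Icc 0 (Real.pi / 2))
    (α : ℝ)
    (hα : ∀ r : V → ℝ, (∀ i, 0 < r i) →
      α * AlphaFlow.sAlpha T α r <
        AlphaFlow.firstPosEigenvalue (-AlphaFlow.alphaLaplacian T Φ α r)) :
    -- the flow has a unique solution, defined for all times, for every initial metric
    (∀ u₀ : V → ℝ, ∃! u : ℝ → V → ℝ, AlphaFlow.IsAlphaFlow T Φ α u ∧ u 0 = u₀) ∧
    -- each solution converges iff a constant curvature metric exists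
    (∀ u : ℝ → V → ℝ, AlphaFlow.IsAlphaFlow T Φ α u →
      ((∃ u' : V → ℝ, Tendsto u atTop (𝓝 u')) ↔
        ∃ r : V → ℝ, AlphaFlow.IsConstAlphaCurvMetric T Φ α r)) ∧
    -- in that case it converges exponentially fast to a constant curvature metric
    ((∃ r : V → ℝ, AlphaFlow.IsConstAlphaCurvMetric T Φ α r) →
      ∀ u : ℝ → V → ℝ, AlphaFlow.IsAlphaFlow T Φ α u →
        ∃ u' : V → ℝ, AlphaFlow.IsConstAlphaCurvMetric T Φ α (AlphaFlow.metricOf u') ∧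
          ∃ C δ : ℝ, 0 < δ ∧ ∀ t : ℝ, 0 ≤ t → ‖u t - u'‖ ≤ C * Real.exp (-δ * t)) ∧
    -- the potential is well defined, and strictly convex on the hyperplane; it is
    -- moreover proper there, with limit `+∞` at infinity, if a constant curvature metric exists
    (∀ u₀ : V → ℝ,
      (∀ u, HasFDerivAt (AlphaFlow.alphaPotential T Φ α u₀) (AlphaFlow.alphaForm T Φ α u) u) ∧
      StrictConvexOn ℝ (AlphaFlow.sumZero V) (AlphaFlow.alphaPotential T Φ α u₀) ∧
      ((∃ r : V → ℝ, AlphaFlow.IsConstAlphaCurvMetric T Φ α r) →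
        IsProperMap ((AlphaFlow.sumZero V).domRestrict (AlphaFlow.alphaPotential T Φ α u₀)) ∧
        Tendsto ((AlphaFlow.sumZero V).domRestrict (AlphaFlow.alphaPotential T Φ α u₀))
          (cocompact (AlphaFlow.sumZero V)) atTop)) := by
  have : Nonempty V := hT.connected.nonempty
  have hG := AlphaFlow.isMonotoneField_curvDefect hT hΦ hα
  refine ⟨AlphaFlow.existsUnique_alphaFlow hT hΦ, fun u hu => ⟨?_, fun hr => ?_⟩,
    fun hr u hu => AlphaFlow.exists_exp_convergence hT hΦ hα hr hu, fun u₀ => ?_⟩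
  · rintro ⟨u', hu'⟩
    exact (AlphaFlow.exists_isConstAlphaCurvMetric_iff hT hΦ).2
      ⟨u', AlphaFlow.curvDefect_eq_zero_of_tendsto hT hΦ hu hu'⟩
  · obtain ⟨u', -, C, δ, hδ, h⟩ := AlphaFlow.exists_exp_convergence hT hΦ hα hr hu
    exact ⟨u', AlphaFlow.tendsto_of_exp_bound hδ h⟩
  -- By definition, `alphaForm` is the form with coefficients `curvDefect`.
  · have hF : ∀ u, HasFDerivAt (AlphaFlow.alphaPotential T Φ α u₀)
        (AlphaFlow.alphaForm T Φ α u) u := hG.hasFDerivAt_curveIntegral_segment u₀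
    refine ⟨hF, hG.strictConvexOn_potential hF, fun hr => ?_⟩
    obtain ⟨x, hx⟩ := (AlphaFlow.exists_isConstAlphaCurvMetric_iff hT hΦ).1 hr
    exact ⟨hG.isProperMap_potential hF hx, hG.tendsto_potential_atTop hF hx⟩
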